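/- **Theorem 1 ($\epsilon$-optimality of the perturbed policy).** Let $\mathcal M=(S,s_1,\mathcal A,\mathcal P)$ be a finite Markov decision process in which the set $\mathcal A(s)$ of available actions is non-empty for every $s\in S$. Let $B\subseteq S$ be a set of absorbing states, $c:S\times\mathcal A\to\mathbb R_{\ge 0}$ a cost function and $\beta\in(0,1)$. For a (randomized Markovian) policy $\pi$ let $J(\pi)=\mathbb E^\pi\big[\sum_{t\ge1}\beta^{t-1}c(s_t,a_t)\big]$ with the path starting at $s_1$, and let $\Xi(\mathcal M,B)$ be the set of policies that maximize the probability of reaching $B$ from $s_1$. For $\epsilon>0$, a policy $\bar\pi\in\Xi(\mathcal M,B)$ is called $\epsilon$-optimal if $J(\bar\pi)\le\inf_{\pi\in\Xi(\mathcal M,B)}J(\pi)+\epsilon$. Let $x_s$ be the maximum probability of reaching $B$ from $s$, let $S_0$ be the set of states from which $B$ is reached with probability zero under every policy, let $S_r=S\setminus(B\cup S_0)$, and put $\mathcal A_{\max}(s)=\{a\in\mathcal A(s): x_s=\sum_{s'}\mathcal P_{s,a,s'}x_{s'}\}$. The cleaned-up process $\mathcal M'$ arises from $\mathcal M$ by removing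 the actions in $\mathcal A(s)\setminus\mathcal A_{\max}(s)$ from every state $s\in S_r$. Let $\tilde\pi$ be a stationary deterministic policy of $\mathcal M'$ that minimizes $J$ over all policies of $\mathcal M'$. Put $\mathcal A_{act}(s)=\{a\in\mathcal A_{\max}(s):\tilde\pi(s,a)>0\}$, $\mathcal A_{pass}(s)=\mathcal A_{\max}(s)\setminus\mathcal A_{act}(s)$, $\rho(s)=|\mathcal A_{pass}(s)|/|\mathcal A_{act}(s)|$, and for $\epsilon'>0$ $$\tilde\pi'(s,a)=\begin{cases}\epsilon'&\text{if }a\in\mathcal A_{pass}(s),\\ \tilde\pi(s,a)-\epsilon'\rho(s)&\text{if }a\in\mathcal A_{act}(s),\\ 0&\text{otherwise.}\end{cases}$$ For a stationary policy $\pi$ let $\mathcal P^\pi_{s,s'}=\sum_{a\in\mathcal A(s)}\pi(s,a)\mathcal P_{s,a,s'}$ and $c^\pi_s=\sum_{a\in\mathcal A_{\max}(s)}\pi(s,a)c(s,a)$; let $\alpha$ be the indicator vector of $s_1$, and $$N(s,s')=\sum_{a\in\mathcal A_{pass}(s)}\mathcal P_{s,a,s'}-\rho(s)\sum_{a\in\mathcal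 A_{act}(s)}\mathcal P_{s,a,s'},\qquad v_s=\sum_{a\in\mathcal A_{pass}(s)}c(s,a)-\rho(s)\sum_{a\in\mathcal A_{act}(s)}c(s,a),$$ $$\gamma_1=\beta\,\alpha^T(I-\beta\mathcal P^{\tilde\pi})^{-1}N(I-\beta\mathcal P^{\tilde\pi'})^{-1}c^{\tilde\pi},\qquad \gamma_2=\alpha^T(I-\beta\mathcal P^{\tilde\pi'})^{-1}v.$$ Then for every $\epsilon>0$: 1. if $\epsilon'>0$ is so small that $\tilde\pi'(s,a)>0$ for all $s\in S$ and $a\in\mathcal A_{\max}(s)$, and if $\epsilon'\le\epsilon/(\gamma_1+\gamma_2)$ (no constraint when $\gamma_1+\gamma_2=0$), then $\tilde\pi'$ is a stationary policy of $\mathcal M'$ and is $\epsilon$-optimal; 2. a policy $\tilde\pi$ as above exists, and for every such $\tilde\pi$ there is an $\epsilon'$ that satisfies the conditions in 1. Hence an $\epsilon$-optimal stationary policy of $\mathcal M$ always exists. -/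

import Mathlib

open MeasureTheory ProbabilityTheory
open scoped Matrix

noncomputable section

/-- A finite Markov decision process with states `S` and actions `A`: an initial state, the set
`act s` of actions available in `s`, and transition probabilities that form a distribution for
every available action. (That every state has an available action is a hypothesis where needed.) -/
structure MDP (S A : Type*) [Fintype S] where
  init : S
  act : S → Finset A
  prob : S → A → S → ℝ
  prob_nonneg : ∀ s a s', 0 ≤ prob s a s'
  prob_le_one : ∀ s a s', prob s a s' ≤ 1
  prob_sum : ∀ s, ∀ a ∈ act s, ∑ s', prob s a s' = 1

namespace MDP

open Classical in
/-- The probability distribution with weights `w`, on a finite type; a point mass at `i₀` if the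
weights do not form a probability distribution. -/
def pmfOfWeights {ι : Type*} [Fintype ι] (w : ι → ℝ) (i₀ : ι) : PMF ι :=
  if h : (∀ i, 0 ≤ w i) ∧ ∑ i, w i = 1 then
    PMF.ofFintype (fun i => ENNReal.ofReal (w i)) (by
      rw [← ENNReal.ofReal_sum_of_nonneg (fun i _ => h.1 i), h.2, ENNReal.ofReal_one])
  else PMF.pure i₀

variable {S A : Type*} [Fintype S] [Fintype A]

/-- A state is absorbing if every available action stays there with probability one. -/
def IsAbsorbing (M : MDP S A) (s : S) : Prop := ∀ a ∈ M.act s, M.prob s a s = 1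

/-! ### Policies -/

/-- `d` is a randomized decision rule: for each state, a distribution on the available actions. -/
def IsRule (M : MDP S A) (d : S → A → ℝ) : Prop :=
  ∀ s, (∀ a, 0 ≤ d s a) ∧ (∀ a, a ∉ M.act s → d s a = 0) ∧ ∑ a ∈ M.act s, d s a = 1

/-- All (Markovian, randomized) policies `(d₀, d₁, d₂, …)`. -/
def policies (M : MDP S A) : Set (ℕ → S → A → ℝ) := {π | ∀ t, M.IsRule (π t)}

/-- The policy that uses the rule `d` at all times. -/
def stationary (d : S → A → ℝ) : ℕ → S → A → ℝ := fun _ => d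

/-- The stationary policies. -/
def stationaryPolicies (M : MDP S A) : Set (ℕ → S → A → ℝ) :=
  {π | π ∈ M.policies ∧ ∃ d, π = stationary d}

/-- `d` is a deterministic rule: some available action has probability one in each state. -/
def IsDetRule (M : MDP S A) (d : S → A → ℝ) : Prop :=
  M.IsRule d ∧ ∀ s, ∃ a ∈ M.act s, d s a = 1

/-! ### The law of the state-action process -/

section Law

variable [MeasurableSpace S] [DiscreteMeasurableSpace S]
  [MeasurableSpace A] [DiscreteMeasurableSpace A]

/-- The law of the first state-action pair when the initial state is `s` and the first decision
rule is `d`. -/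
def initLaw (d : S → A → ℝ) (s : S) : Measure (S × A) :=
  ∑ a, ENNReal.ofReal (d s a) • Measure.dirac (s, a)

/-- The law of the state-action pair that follows `(s, a)`: the next state `s'` has probability
`prob s a s'`, and then the action `a'` has probability `d s' a'`. -/
def stepKernel (M : MDP S A) (d : S → A → ℝ) : Kernel (S × A) (S × A) :=
  Kernel.ofFunOfCountable fun p =>
    (pmfOfWeights (fun q : S × A => M.prob p.1 p.2 q.1 * d q.1 q.2) p).toMeasure

/-- The same law as a function of the history up to time `t`, of which only the last entry
matters. -/
def histKernel (M : MDP S A) (π : ℕ → S → A → ℝ) (t : ℕ) :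
    Kernel (Π _ : Finset.Iic t, S × A) (S × A) :=
  (M.stepKernel (π (t + 1))).comap (fun h => h ⟨t, Finset.mem_Iic.2 le_rfl⟩)
    (measurable_pi_apply _)

instance (M : MDP S A) (d : S → A → ℝ) : IsMarkovKernel (M.stepKernel d) :=
  ⟨fun p => by
    change IsProbabilityMeasure (PMF.toMeasure _)
    infer_instance⟩

instance (M : MDP S A) (π : ℕ → S → A → ℝ) (t : ℕ) : IsMarkovKernel (M.histKernel π t) := by
  unfold histKernel
  infer_instance

/-- The law of the infinite state-action path `(s₀, a₀), (s₁, a₁), …` generated by the policy `π`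
from the state `s₀ = s`. -/
def pathLaw (M : MDP S A) (π : ℕ → S → A → ℝ) (s : S) : Measure (ℕ → S × A) :=
  Kernel.trajMeasure (X := fun _ => S × A) (initLaw (π 0) s) (M.histKernel π)

/-- The probability that the path from `s` under `π` reaches the set `B`. -/
def reachProb (M : MDP S A) (B : Set S) (π : ℕ → S → A → ℝ) (s : S) : ℝ :=
  (M.pathLaw π s).real {ω | ∃ t, (ω t).1 ∈ B}

/-- The expected total discounted cost of `π` from the initial state. -/
def cost (M : MDP S A) (c : S → A → ℝ) (β : ℝ) (π : ℕ → S → A → ℝ) : ℝ :=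
  ∫ ω, ∑' t : ℕ, β ^ t * c (ω t).1 (ω t).2 ∂(M.pathLaw π M.init)

/-- The policies that reach `B` from the initial state with maximum probability. -/
def maxReachPolicies (M : MDP S A) (B : Set S) : Set (ℕ → S → A → ℝ) :=
  {π | π ∈ M.policies ∧ ∀ π' ∈ M.policies, M.reachProb B π' M.init ≤ M.reachProb B π M.init}

/-- `π` is `ε`-optimal for minimizing the discounted cost over the policies that maximize the
probability of reaching `B`. -/
def IsEpsOptimal (M : MDP S A) (B : Set S) (c : S → A → ℝ) (β ε : ℝ) (π : ℕ → S → A → ℝ) : Prop :=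
  π ∈ M.maxReachPolicies B ∧ M.cost c β π ≤ sInf (M.cost c β '' M.maxReachPolicies B) + ε

/-! ### The cleaned-up MDP -/

/-- The maximum probability of reaching `B` from `s`. -/
def maxReach (M : MDP S A) (B : Set S) (s : S) : ℝ :=
  sSup ((fun π => M.reachProb B π s) '' M.policies)

/-- The states from which `B` is reached with probability zero under every policy. -/
def zeroStates (M : MDP S A) (B : Set S) : Set S :=
  {s | ∀ π ∈ M.policies, M.reachProb B π s = 0}

open Classical in
/-- The available actions that preserve the maximum probability of reaching `B`. -/
def maxAct (M : MDP S A) (B : Set S) (s : S) : Finset A :=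
  (M.act s).filter fun a => M.maxReach B s = ∑ s', M.prob s a s' * M.maxReach B s'

open Classical in
/-- The cleaned-up MDP: the actions outside `maxAct` are removed from every state that is neither
in `B` nor in `zeroStates`. -/
def cleanUp (M : MDP S A) (B : Set S) : MDP S A where
  init := M.init
  act s := if s ∉ B ∪ M.zeroStates B then M.maxAct B s else M.act s
  prob := M.prob
  prob_nonneg := M.prob_nonneg
  prob_le_one := M.prob_le_one
  prob_sum s a ha := by
    refine M.prob_sum s a ?_
    by_cases h : s ∉ B ∪ M.zeroStates B
    · rw [if_pos h] at ha
      exact (Finset.mem_filter.1 ha).1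
    · rwa [if_neg h] at ha

/-- `d` is the rule of a stationary deterministic policy that minimizes the discounted cost on the
cleaned-up MDP, over all of its policies. -/
def IsCleanOptimal (M : MDP S A) (B : Set S) (c : S → A → ℝ) (β : ℝ) (d : S → A → ℝ) : Prop :=
  (M.cleanUp B).IsDetRule d ∧
    ∀ π ∈ (M.cleanUp B).policies,
      (M.cleanUp B).cost c β (stationary d) ≤ (M.cleanUp B).cost c β π

/-! ### The perturbed policy -/

open Classical in
/-- The actions of `maxAct` that the rule `d` uses. -/
def usedAct (M : MDP S A) (B : Set S) (d : S → A → ℝ) (s : S) : Finset A :=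
  (M.maxAct B s).filter fun a => 0 < d s a

open Classical in
/-- The actions of `maxAct` that the rule `d` does not use. -/
def unusedAct (M : MDP S A) (B : Set S) (d : S → A → ℝ) (s : S) : Finset A :=
  M.maxAct B s \ M.usedAct B d s

/-- The ratio of the numbers of unused and used actions. -/
def actRatio (M : MDP S A) (B : Set S) (d : S → A → ℝ) (s : S) : ℝ :=
  ((M.unusedAct B d s).card : ℝ) / ((M.usedAct B d s).card : ℝ)

open Classical in
/-- The perturbed rule: every unused action of `maxAct` gets the weight `e`, at the expense of the
used ones; the actions outside `maxAct` are not taken. -/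
def perturb (M : MDP S A) (B : Set S) (d : S → A → ℝ) (e : ℝ) (s : S) (a : A) : ℝ :=
  if a ∈ M.unusedAct B d s then e
  else if a ∈ M.usedAct B d s then d s a - e * M.actRatio B d s
  else 0

/-- The transition matrix of the Markov chain induced by a stationary policy. -/
def chainMatrix (M : MDP S A) (d : S → A → ℝ) : Matrix S S ℝ :=
  Matrix.of fun s s' => ∑ a ∈ M.act s, d s a * M.prob s a s'

/-- The expected one-step costs of a stationary policy on the cleaned-up MDP. -/
def costVec (M : MDP S A) (B : Set S) (c : S → A → ℝ) (d : S → A → ℝ) : S → ℝ :=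
  fun s => ∑ a ∈ M.maxAct B s, d s a * c s a

/-- The perturbation matrix. -/
def pertMatrix (M : MDP S A) (B : Set S) (d : S → A → ℝ) : Matrix S S ℝ :=
  Matrix.of fun s s' => ∑ a ∈ M.unusedAct B d s, M.prob s a s' -
    M.actRatio B d s * ∑ a ∈ M.usedAct B d s, M.prob s a s'

/-- The perturbation vector. -/
def pertVec (M : MDP S A) (B : Set S) (c : S → A → ℝ) (d : S → A → ℝ) : S → ℝ :=
  fun s => ∑ a ∈ M.unusedAct B d s, c s a -
    M.actRatio B d s * ∑ a ∈ M.usedAct B d s, c s a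

open Classical in
/-- `γ₁ = β αᵀ (1 - β P)⁻¹ N (1 - β P')⁻¹ c`, where `α` is the initial distribution, `P` and `P'`
are the transition matrices of the policy and of its perturbation, `N` is the perturbation matrix
and `c` is the cost vector of the policy. -/
def gamma1 (M : MDP S A) (B : Set S) (c : S → A → ℝ) (β : ℝ) (d : S → A → ℝ) (e : ℝ) : ℝ :=
  β * (Pi.single M.init 1 ⬝ᵥ
    (((1 - β • M.chainMatrix d)⁻¹ * M.pertMatrix B d *
      (1 - β • M.chainMatrix (M.perturb B d e))⁻¹) *ᵥ M.costVec B c d))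

open Classical in
/-- `γ₂ = αᵀ (1 - β P')⁻¹ v`, with the perturbation vector `v`. -/
def gamma2 (M : MDP S A) (B : Set S) (c : S → A → ℝ) (β : ℝ) (d : S → A → ℝ) (e : ℝ) : ℝ :=
  Pi.single M.init 1 ⬝ᵥ
    ((1 - β • M.chainMatrix (M.perturb B d e))⁻¹ *ᵥ M.pertVec B c d)

/-- The weight `e` is admissible for the accuracy `ε`: it is positive, it is so small that the
perturbed rule gives a positive weight to every action of `maxAct`, and `e ≤ ε / (γ₁ + γ₂)`
(no constraint if `γ₁ + γ₂ = 0`). -/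
def IsAdmissible (M : MDP S A) (B : Set S) (c : S → A → ℝ) (β : ℝ) (d : S → A → ℝ) (ε e : ℝ) :
    Prop :=
  0 < e ∧ (∀ s, ∀ a ∈ M.maxAct B s, 0 < M.perturb B d e s a) ∧
    (M.gamma1 B c β d e + M.gamma2 B c β d e = 0 ∨
      e ≤ ε / (M.gamma1 B c β d e + M.gamma2 B c β d e))

end Law

end MDP

end

/-! Write `x` for `maxReach B`. It is the limit of value iteration and the least superharmonic
function above the indicator of `B`; everything about reachability rests on this.

Lower bound. Under a policy attaining `x` at the initial state, the expectation of `x` never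
increases, yet never drops below the attained value `x M.init`. So it is constant, and every action
taken in a visited state lies in `maxAct` (`mem_maxAct_of_reachProb_eq`). The Bellman equation of
the cleaned-up process then shows that the policy costs at least as much as the clean optimum `d`
(`IsCleanOptimal.cost_le`). However, `d` itself may miss the maximum probability: actions that
preserve `x` can postpone the arrival in `B` forever.

Repair. A stationary rule giving positive weight to exactly the actions of `maxAct` does attain `x`
(`reachProb_stationary_eq_maxReach`). If its reachability `y` were smaller than `x` somewhere, the
set where `x - y` is maximal would be closed under `maxAct` and disjoint from `B`, so `y = 0` and
`x` is a positive constant there. Lowering `x` slightly on that set would give a smaller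
superharmonic majorant of the indicator (`exists_maxAct_leaving`).

Price. By the resolvent identity the perturbation changes the cost by exactly `e * (γ₁ + γ₂)`
(`cost_perturb_sub_cost`), and optimality of `d` makes this nonnegative. Since `γ₁ + γ₂` is
continuous in `e` at `0`, the product tends to `0`, so admissible weights exist. -/

set_option linter.unusedSectionVars false

noncomputable section

open Filter Topology

namespace MDP

variable {S A : Type*} [Fintype S] [Fintype A]

/-! ### Decision rules and one-step expectations -/

namespace IsRule

variable {M : MDP S A} {d : S → A → ℝ}

lemma nonneg (hd : M.IsRule d) (s : S) (a : A) : 0 ≤ d s a := (hd s).1 a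

lemma eq_zero (hd : M.IsRule d) {s : S} {a : A} (ha : a ∉ M.act s) : d s a = 0 := (hd s).2.1 a ha

lemma mem_act (hd : M.IsRule d) {s : S} {a : A} (ha : d s a ≠ 0) : a ∈ M.act s :=
  not_imp_comm.1 hd.eq_zero ha

lemma sum_act_mul (hd : M.IsRule d) (s : S) (g : A → ℝ) :
    ∑ a ∈ M.act s, d s a * g a = ∑ a, d s a * g a :=
  Finset.sum_subset (Finset.subset_univ _) fun a _ ha => by rw [hd.eq_zero ha, zero_mul]

lemma sum_eq_one (hd : M.IsRule d) (s : S) : ∑ a, d s a = 1 := by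
  simpa [(hd s).2.2] using (hd.sum_act_mul s fun _ => 1).symm

/-- An average with respect to a decision rule is at most a common upper bound. -/
lemma sum_mul_le (hd : M.IsRule d) {s : S} {g : A → ℝ} {m : ℝ} (h : ∀ a ∈ M.act s, g a ≤ m) :
    ∑ a, d s a * g a ≤ m := by
  rw [← hd.sum_act_mul]
  calc ∑ a ∈ M.act s, d s a * g a ≤ ∑ a ∈ M.act s, d s a * m :=
        Finset.sum_le_sum fun a ha => mul_le_mul_of_nonneg_left (h a ha) (hd.nonneg s a)
    _ = m := by rw [← Finset.sum_mul, (hd s).2.2, one_mul]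

end IsRule

/-- The expected value of `f` after one step from `s` with action `a`. -/
def backup (M : MDP S A) (f : S → ℝ) (s : S) (a : A) : ℝ := ∑ s', M.prob s a s' * f s'

/-- The expected value of `f` after one step from `s` with the decision rule `d`. -/
def ruleBackup (M : MDP S A) (d : S → A → ℝ) (f : S → ℝ) (s : S) : ℝ :=
  ∑ a, d s a * M.backup f s a

lemma backup_mono (M : MDP S A) {f g : S → ℝ} (h : f ≤ g) (s : S) (a : A) :
    M.backup f s a ≤ M.backup g s a :=
  Finset.sum_le_sum fun s' _ => mul_le_mul_of_nonneg_left (h s') (M.prob_nonneg s a s')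

lemma backup_nonneg (M : MDP S A) {f : S → ℝ} (h : 0 ≤ f) (s : S) (a : A) :
    0 ≤ M.backup f s a :=
  Finset.sum_nonneg fun s' _ => mul_nonneg (M.prob_nonneg s a s') (h s')

lemma backup_const (M : MDP S A) {s : S} {a : A} (ha : a ∈ M.act s) (m : ℝ) :
    M.backup (fun _ => m) s a = m := by
  rw [backup, ← Finset.sum_mul, M.prob_sum s a ha, one_mul]

lemma backup_sub (M : MDP S A) (f g : S → ℝ) (s : S) (a : A) :
    M.backup (f - g) s a = M.backup f s a - M.backup g s a := by
  simp [backup, mul_sub]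

lemma backup_le (M : MDP S A) {f : S → ℝ} {m : ℝ} (h : ∀ s, f s ≤ m) {s : S} {a : A}
    (ha : a ∈ M.act s) : M.backup f s a ≤ m :=
  (M.backup_mono h s a).trans_eq (M.backup_const ha m)

lemma tendsto_backup (M : MDP S A) {f : ℕ → S → ℝ} {g : S → ℝ}
    (h : ∀ s, Tendsto (fun n => f n s) atTop (𝓝 (g s))) (s : S) (a : A) :
    Tendsto (fun n => M.backup (f n) s a) atTop (𝓝 (M.backup g s a)) :=
  tendsto_finsetSum _ fun s' _ => (h s').const_mul _

lemma backup_congr (M : MDP S A) {f g : S → ℝ} {s : S} {a : A}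
    (h : ∀ s', M.prob s a s' ≠ 0 → f s' = g s') : M.backup f s a = M.backup g s a := by
  refine Finset.sum_congr rfl fun s' _ => ?_
  by_cases hp : M.prob s a s' = 0
  · simp [hp]
  · rw [h s' hp]

lemma ruleBackup_sub (M : MDP S A) (d : S → A → ℝ) (f g : S → ℝ) (s : S) :
    M.ruleBackup d (f - g) s = M.ruleBackup d f s - M.ruleBackup d g s := by
  simp [ruleBackup, backup_sub, mul_sub]

lemma IsAbsorbing.prob_eq_zero {M : MDP S A} {s s' : S} (h : M.IsAbsorbing s) {a : A}
    (ha : a ∈ M.act s) (hs : s' ≠ s) : M.prob s a s' = 0 := by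
  classical
  have h1 := M.prob_sum s a ha
  rw [← Finset.add_sum_erase _ _ (Finset.mem_univ s), h a ha, add_eq_left,
    Finset.sum_eq_zero_iff_of_nonneg fun _ _ => M.prob_nonneg _ _ _] at h1
  exact h1 s' (by simp [hs])

lemma IsAbsorbing.backup_eq {M : MDP S A} {s : S} (h : M.IsAbsorbing s) {a : A}
    (ha : a ∈ M.act s) (f : S → ℝ) : M.backup f s a = f s := by
  rw [M.backup_congr (g := fun _ => f s), M.backup_const ha]
  intro s' hp
  by_contra hne
  exact hp (h.prob_eq_zero ha fun e => hne (by rw [e]))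

open Classical in
/-- The deterministic rule that takes the action `f s` in the state `s`. -/
def detRule (f : S → A) (s : S) (a : A) : ℝ := if a = f s then 1 else 0

lemma sum_detRule_mul (f : S → A) (s : S) (g : A → ℝ) : ∑ a, detRule f s a * g a = g (f s) := by
  classical
  simp [detRule]

lemma isDetRule_detRule {M : MDP S A} {f : S → A} (hf : ∀ s, f s ∈ M.act s) :
    M.IsDetRule (detRule f) := by
  classical
  refine ⟨fun s => ⟨fun a => ?_, fun a ha => ?_, ?_⟩, fun s => ⟨f s, hf s, by simp [detRule]⟩⟩
  · unfold detRule; split_ifs <;> norm_num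
  · exact if_neg fun h : a = f s => ha (by rw [h]; exact hf s)
  · simp_rw [detRule]
    rw [Finset.sum_ite_eq', if_pos (hf s)]

lemma policies_nonempty {M : MDP S A} (hact : ∀ s, (M.act s).Nonempty) : M.policies.Nonempty := by
  choose f hf using hact
  exact ⟨stationary (detRule f), fun _ => (isDetRule_detRule hf).1⟩

/-! ### Occupation probabilities -/

open Classical in
/-- The probability that the policy `π` started in `s` is in `s'` at time `t`, by forward
recursion. -/
def occ (M : MDP S A) (π : ℕ → S → A → ℝ) (s : S) : ℕ → S → ℝ
  | 0 => fun s' => if s' = s then 1 else 0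
  | t + 1 => fun s' => ∑ s₀, ∑ a, occ M π s t s₀ * π t s₀ a * M.prob s₀ a s'

/-- The expected value of `f` at the state at time `t`. -/
def expVal (M : MDP S A) (π : ℕ → S → A → ℝ) (s : S) (t : ℕ) (f : S → ℝ) : ℝ :=
  ∑ s', M.occ π s t s' * f s'

variable {M : MDP S A} {π : ℕ → S → A → ℝ}

lemma occ_nonneg (hπ : π ∈ M.policies) (s : S) (t : ℕ) (s' : S) : 0 ≤ M.occ π s t s' := by
  induction t generalizing s' with
  | zero => unfold occ; split_ifs <;> norm_num
  | succ t ih =>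
    exact Finset.sum_nonneg fun s₀ _ => Finset.sum_nonneg fun a _ =>
      mul_nonneg (mul_nonneg (ih s₀) ((hπ t).nonneg s₀ a)) (M.prob_nonneg _ _ _)

@[simp]
lemma expVal_zero (M : MDP S A) (π : ℕ → S → A → ℝ) (s : S) (f : S → ℝ) :
    M.expVal π s 0 f = f s := by
  classical
  simp [expVal, occ]

/-- Shifts one step of the dynamics from the distribution to the test function, so that one-step
inequalities between functions of the state propagate in time. -/
lemma expVal_succ (M : MDP S A) (π : ℕ → S → A → ℝ) (s : S) (t : ℕ) (f : S → ℝ) :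
    M.expVal π s (t + 1) f = M.expVal π s t (M.ruleBackup (π t) f) := by
  simp only [expVal, occ, ruleBackup, backup, Finset.sum_mul, Finset.mul_sum]
  rw [Finset.sum_comm]
  refine Finset.sum_congr rfl fun s₀ _ => ?_
  rw [Finset.sum_comm]
  refine Finset.sum_congr rfl fun a _ => Finset.sum_congr rfl fun s' _ => by ring

lemma expVal_mono (hπ : π ∈ M.policies) (s : S) (t : ℕ) {f g : S → ℝ} (h : f ≤ g) :
    M.expVal π s t f ≤ M.expVal π s t g :=
  Finset.sum_le_sum fun s' _ => mul_le_mul_of_nonneg_left (h s') (occ_nonneg hπ s t s')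

lemma expVal_const (hπ : π ∈ M.policies) (s : S) (t : ℕ) (m : ℝ) :
    M.expVal π s t (fun _ => m) = m := by
  induction t with
  | zero => simp
  | succ t ih =>
    rw [expVal_succ]
    convert ih using 2
    funext s'
    rw [ruleBackup, ← (hπ t).sum_act_mul,
      Finset.sum_congr rfl fun a ha => by rw [M.backup_const ha m],
      ← Finset.sum_mul, (hπ t s').2.2, one_mul]

lemma expVal_sub (M : MDP S A) (π : ℕ → S → A → ℝ) (s : S) (t : ℕ) (f g : S → ℝ) :
    M.expVal π s t (f - g) = M.expVal π s t f - M.expVal π s t g := by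
  simp [expVal, mul_sub]

lemma abs_expVal_le (hπ : π ∈ M.policies) (s : S) (t : ℕ) {f : S → ℝ} {m : ℝ}
    (h : ∀ s, |f s| ≤ m) : |M.expVal π s t f| ≤ m := by
  rw [abs_le]
  constructor
  · rw [← expVal_const hπ s t (-m)]
    exact expVal_mono hπ s t fun s' => (abs_le.1 (h s')).1
  · rw [← expVal_const hπ s t m]
    exact expVal_mono hπ s t fun s' => (abs_le.1 (h s')).2

lemma expVal_stationary (M : MDP S A) (d : S → A → ℝ) (s : S) (t : ℕ) (f : S → ℝ) :
    M.expVal (stationary d) s t f = (M.ruleBackup d)^[t] f s := by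
  induction t generalizing f with
  | zero => simp
  | succ t ih => rw [expVal_succ, Function.iterate_succ_apply, ← ih]; rfl

/-! ### The marginals of the path law -/

section Law

variable [MeasurableSpace S] [DiscreteMeasurableSpace S]
  [MeasurableSpace A] [DiscreteMeasurableSpace A]

lemma initLaw_singleton (d : S → A → ℝ) (s : S) (p : S × A) [Decidable (p.1 = s)] :
    initLaw d s {p} = if p.1 = s then ENNReal.ofReal (d s p.2) else 0 := by
  classical
  rw [initLaw, Measure.finsetSum_apply]
  obtain ⟨s', a'⟩ := p
  by_cases h : s' = s
  · subst h
    rw [Finset.sum_eq_single a'] <;> simp +contextual [Set.indicator]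
  · simp [Set.indicator, h, Ne.symm h]

lemma isProbabilityMeasure_initLaw {d : S → A → ℝ} (hd : M.IsRule d) (s : S) :
    IsProbabilityMeasure (initLaw d s) := by
  constructor
  rw [initLaw, Measure.finsetSum_apply]
  simp only [Measure.smul_apply, measure_univ, smul_eq_mul, mul_one]
  rw [← ENNReal.ofReal_sum_of_nonneg fun a _ => hd.nonneg s a, hd.sum_eq_one, ENNReal.ofReal_one]

/-- Availability of `p.2` makes the weights sum to one; otherwise `pmfOfWeights` may fall back to
its default point mass. -/
lemma stepKernel_real_singleton {d : S → A → ℝ} (hd : M.IsRule d) {p : S × A}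
    (hp : p.2 ∈ M.act p.1) (q : S × A) :
    (M.stepKernel d p).real {q} = M.prob p.1 p.2 q.1 * d q.1 q.2 := by
  have hw : (∀ q : S × A, 0 ≤ M.prob p.1 p.2 q.1 * d q.1 q.2) ∧
      ∑ q : S × A, M.prob p.1 p.2 q.1 * d q.1 q.2 = 1 := by
    refine ⟨fun q => mul_nonneg (M.prob_nonneg _ _ _) (hd.nonneg _ _), ?_⟩
    rw [Fintype.sum_prod_type]
    simp_rw [← Finset.mul_sum, hd.sum_eq_one, mul_one]
    exact M.prob_sum _ _ hp
  change (PMF.toMeasure (pmfOfWeights _ _)).real {q} = _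
  rw [measureReal_def, PMF.toMeasure_apply_singleton _ _ (measurableSet_singleton q),
    pmfOfWeights, dif_pos hw, PMF.ofFintype_apply, ENNReal.toReal_ofReal (hw.1 q)]

lemma isProbabilityMeasure_pathLaw (hπ : π ∈ M.policies) (s : S) :
    IsProbabilityMeasure (M.pathLaw π s) := by
  have := isProbabilityMeasure_initLaw (hπ 0) s
  unfold pathLaw
  infer_instance

lemma map_eval_zero_pathLaw (M : MDP S A) (π : ℕ → S → A → ℝ) (s : S) :
    (M.pathLaw π s).map (fun ω => ω 0) = initLaw (π 0) s := by
  have h : (M.pathLaw π s).map (Preorder.frestrictLe 0) =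
      (initLaw (π 0) s).map (MeasurableEquiv.piUnique fun _ : Finset.Iic 0 => S × A).symm := by
    rw [pathLaw, Kernel.trajMeasure, Measure.map_comp _ _ (by fun_prop),
      Kernel.traj_map_frestrictLe, Kernel.partialTraj_self, Measure.id_comp]
  have h2 : (fun ω : ℕ → S × A => ω 0) =
      (fun h : (Π _ : Finset.Iic 0, S × A) => h ⟨0, Finset.mem_Iic.2 le_rfl⟩) ∘
        Preorder.frestrictLe 0 := rfl
  rw [h2, ← Measure.map_map (by fun_prop) (by fun_prop), h,
    Measure.map_map (by fun_prop) (by fun_prop)]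
  exact Measure.map_id

/-- The joint law of the history and the next entry is a composition product, and the kernel is
constant on the event that the last entry of the history is `p`. -/
lemma pathLaw_pair (hπ : π ∈ M.policies) (s : S) (t : ℕ) (p q : S × A) :
    (M.pathLaw π s).real {ω | ω t = p ∧ ω (t + 1) = q} =
      (M.pathLaw π s).real {ω | ω t = p} * (M.stepKernel (π (t + 1)) p).real {q} := by
  have := isProbabilityMeasure_initLaw (hπ 0) s
  have := isProbabilityMeasure_pathLaw hπ s
  let g : (Π _ : Finset.Iic t, S × A) → S × A := fun h => h ⟨t, Finset.mem_Iic.2 le_rfl⟩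
  have hg : Measurable g := measurable_pi_apply _
  have h := Kernel.map_frestrictLe_trajMeasure_compProd_eq_map_trajMeasure
    (X := fun _ => S × A) (μ₀ := initLaw (π 0) s) (κ := M.histKernel π) (a := t)
  have h2 := congrArg (fun μ => μ ((g ⁻¹' {p}) ×ˢ {q})) h
  have hgp : MeasurableSet (g ⁻¹' {p}) := hg (measurableSet_singleton p)
  rw [Measure.compProd_apply_prod hgp (measurableSet_singleton q),
    Measure.map_apply (by fun_prop) (hgp.prod (measurableSet_singleton q)),
    setLIntegral_congr_fun (g := fun _ => M.stepKernel (π (t + 1)) p {q}) hgp,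
    setLIntegral_const, Measure.map_apply (by fun_prop) hgp] at h2
  · have h3 := congrArg ENNReal.toReal h2
    rw [ENNReal.toReal_mul, mul_comm] at h3
    exact h3.symm
  · intro h (hh : g h = p)
    simp only [histKernel, Kernel.comap_apply]
    change M.stepKernel (π (t + 1)) (g h) {q} = _
    rw [hh]

/-- The marginal of the path law at time `t`. -/
lemma pathLaw_real_eval (hπ : π ∈ M.policies) (s : S) (t : ℕ) (p : S × A) :
    (M.pathLaw π s).real {ω | ω t = p} = M.occ π s t p.1 * π t p.1 p.2 := by
  classical
  have := isProbabilityMeasure_pathLaw hπ s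
  induction t generalizing p with
  | zero =>
    have h : (M.pathLaw π s).real {ω | ω 0 = p} = (initLaw (π 0) s).real {p} := by
      rw [← map_eval_zero_pathLaw M π s,
        map_measureReal_apply (by fun_prop) (measurableSet_singleton p)]
      rfl
    rw [h, measureReal_def, initLaw_singleton, occ]
    by_cases hp : p.1 = s
    · simp [hp, ENNReal.toReal_ofReal ((hπ 0).nonneg _ _)]
    · simp [hp]
  | succ t ih =>
    have h : {ω : ℕ → S × A | ω (t + 1) = p} =
        ⋃ q ∈ Finset.univ, {ω | ω t = q ∧ ω (t + 1) = p} := by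
      ext ω; simp
    have hm : ∀ q : S × A, MeasurableSet {ω : ℕ → S × A | ω t = q ∧ ω (t + 1) = p} := fun q =>
      ((measurableSet_singleton q).preimage (measurable_pi_apply t)).inter
        ((measurableSet_singleton p).preimage (measurable_pi_apply (t + 1)))
    rw [h, measureReal_biUnion_finset (fun q _ q' _ hne => Set.disjoint_left.2 fun ω h1 h2 =>
      hne (h1.1.symm.trans h2.1)) (fun q _ => hm q)]
    have hq : ∀ q : S × A, (M.pathLaw π s).real {ω | ω t = q ∧ ω (t + 1) = p} =
        M.occ π s t q.1 * π t q.1 q.2 * M.prob q.1 q.2 p.1 * π (t + 1) p.1 p.2 := by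
      intro q
      rw [pathLaw_pair hπ, ih]
      -- Pairs with an unavailable action, where the kernel may be a default value, have mass zero.
      by_cases h0 : π t q.1 q.2 = 0
      · simp [h0]
      · rw [stepKernel_real_singleton (hπ (t + 1)) ((hπ t).mem_act h0)]
        ring
    rw [Finset.sum_congr rfl fun q _ => hq q, Fintype.sum_prod_type, occ, Finset.sum_mul]
    simp_rw [Finset.sum_mul]

lemma pathLaw_real_pair (hπ : π ∈ M.policies) (s : S) (t : ℕ) (p q : S × A) :
    (M.pathLaw π s).real {ω | ω t = p ∧ ω (t + 1) = q} =
      M.occ π s t p.1 * π t p.1 p.2 * M.prob p.1 p.2 q.1 * π (t + 1) q.1 q.2 := by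
  rw [pathLaw_pair hπ, pathLaw_real_eval hπ]
  by_cases h0 : π t p.1 p.2 = 0
  · simp [h0]
  · rw [stepKernel_real_singleton (hπ (t + 1)) ((hπ t).mem_act h0)]
    ring

lemma integral_eval_pathLaw (hπ : π ∈ M.policies) (s : S) (t : ℕ) (f : S × A → ℝ) :
    ∫ ω, f (ω t) ∂(M.pathLaw π s) = M.expVal π s t fun s' => ∑ a, π t s' a * f (s', a) := by
  have := isProbabilityMeasure_pathLaw hπ s
  have hm : Measurable fun ω : ℕ → S × A => ω t := measurable_pi_apply t
  have := Measure.isProbabilityMeasure_map (μ := M.pathLaw π s) hm.aemeasurable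
  rw [← integral_map (φ := fun ω : ℕ → S × A => ω t) hm.aemeasurable
    (by fun_prop : AEStronglyMeasurable f _),
    integral_fintype .of_finite, Fintype.sum_prod_type, expVal]
  refine Finset.sum_congr rfl fun s' _ => ?_
  rw [Finset.mul_sum]
  refine Finset.sum_congr rfl fun a _ => ?_
  rw [map_measureReal_apply hm (measurableSet_singleton _)]
  change (M.pathLaw π s).real {ω | ω t = (s', a)} • _ = _
  rw [pathLaw_real_eval hπ, smul_eq_mul, mul_assoc]

/-- The expected discounted cost is the discounted sum of the expected costs. -/
lemma hasSum_cost (hπ : π ∈ M.policies) (c : S → A → ℝ) {β : ℝ} (hβ0 : 0 ≤ β) (hβ1 : β < 1) :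
    HasSum (fun t => β ^ t * M.expVal π M.init t fun s => ∑ a, π t s a * c s a)
      (M.cost c β π) := by
  -- A bound `K` on the finitely many costs gives a geometric majorant, which justifies exchanging
  -- sum and integral.
  have := isProbabilityMeasure_pathLaw hπ M.init
  obtain ⟨K, hK⟩ := (Set.finite_range fun p : S × A => |c p.1 p.2|).bddAbove
  have hK' : ∀ p : S × A, ‖c p.1 p.2‖ ≤ K := fun p => hK ⟨p, rfl⟩
  have hmeas : ∀ t : ℕ, Measurable fun ω : ℕ → S × A => c (ω t).1 (ω t).2 := fun t =>
    (Measurable.of_discrete (f := fun p : S × A => c p.1 p.2)).comp (measurable_pi_apply t)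
  have hint : ∀ t : ℕ, Integrable (fun ω : ℕ → S × A => β ^ t * c (ω t).1 (ω t).2)
      (M.pathLaw π M.init) := fun t =>
    (Integrable.of_bound (hmeas t).aestronglyMeasurable K
      (Eventually.of_forall fun ω => hK' (ω t))).const_mul _
  have hsum : Summable fun t : ℕ =>
      ∫ ω, ‖β ^ t * c (ω t).1 (ω t).2‖ ∂(M.pathLaw π M.init) := by
    refine Summable.of_nonneg_of_le (fun t => integral_nonneg fun ω => norm_nonneg _) (fun t => ?_)
      ((summable_geometric_of_lt_one hβ0 hβ1).mul_right K)
    calc ∫ ω, ‖β ^ t * c (ω t).1 (ω t).2‖ ∂(M.pathLaw π M.init)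
        ≤ ∫ _, β ^ t * K ∂(M.pathLaw π M.init) := by
          refine integral_mono (hint t).norm (integrable_const _) fun ω => ?_
          simp only [norm_mul, norm_pow, Real.norm_of_nonneg hβ0]
          exact mul_le_mul_of_nonneg_left (hK' (ω t)) (pow_nonneg hβ0 t)
      _ = β ^ t * K := by simp
  have h := hasSum_integral_of_summable_integral_norm hint hsum
  simp_rw [integral_const_mul] at h
  simp_rw [← integral_eval_pathLaw hπ M.init _ fun p => c p.1 p.2]
  exact h

/-- The probability of having reached a set of absorbing states is the limit of the probabilities
of being there at time `t`. -/
lemma tendsto_reachProb {B : Set S} (hB : ∀ s ∈ B, M.IsAbsorbing s) (hπ : π ∈ M.policies)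
    (s : S) :
    Tendsto (fun t => M.expVal π s t (B.indicator 1)) atTop (𝓝 (M.reachProb B π s)) := by
  classical
  have := isProbabilityMeasure_pathLaw hπ s
  let F : ℕ → Set (ℕ → S × A) := fun t => {ω | (ω t).1 ∈ B}
  -- Almost no path leaves `B`, so having visited `B` by time `t` agrees almost surely with being in
  -- `B` at time `t`.
  have hae : ∀ᵐ ω ∂(M.pathLaw π s), ∀ t, ω ∈ F t → ω ∈ F (t + 1) := by
    rw [ae_all_iff]
    intro t
    have h : ∀ᵐ ω ∂(M.pathLaw π s), ∀ p q : S × A, p.1 ∈ B → q.1 ∉ B →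
        ¬(ω t = p ∧ ω (t + 1) = q) := by
      rw [ae_all_iff]; intro p
      rw [ae_all_iff]; intro q
      by_cases hp : p.1 ∈ B <;> by_cases hq : q.1 ∈ B <;> simp only [hp, hq, not_true_eq_false,
        not_false_eq_true, true_imp_iff, false_imp_iff, Filter.eventually_true]
      rw [ae_iff]
      simp only [not_not]
      have h0 := pathLaw_real_pair hπ s t p q
      rw [measureReal_def] at h0
      refine ((ENNReal.toReal_eq_zero_iff _).1 (h0.trans ?_)).resolve_right (measure_ne_top _ _)
      by_cases h1 : π t p.1 p.2 = 0
      · simp [h1]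
      · rw [(hB _ hp).prob_eq_zero ((hπ t).mem_act h1) (fun e => hq (by rw [e]; exact hp))]
        simp
    filter_upwards [h] with ω hω h1
    by_contra h2
    exact hω _ _ h1 h2 ⟨rfl, rfl⟩
  have hacc : ∀ t, (M.pathLaw π s) (Set.accumulate F t) = (M.pathLaw π s) (F t) := by
    intro t
    refine measure_congr ?_
    filter_upwards [hae] with ω hω
    refine propext ⟨fun h => ?_, fun h => Set.subset_accumulate h⟩
    obtain ⟨i, hi, h⟩ := Set.mem_accumulate.1 h
    exact Nat.le_induction (P := fun n _ => ω ∈ F n) h (fun n _ ih => hω n ih) t hi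
  have hF : ∀ t, M.expVal π s t (B.indicator 1) = ((M.pathLaw π s) (F t)).toReal := by
    intro t
    have hm : MeasurableSet (F t) := 
      (MeasurableSet.of_discrete (s := {p : S × A | p.1 ∈ B})).preimage (measurable_pi_apply t)
    have h := integral_eval_pathLaw hπ s t fun p => B.indicator 1 p.1
    have h2 : (fun ω : ℕ → S × A => B.indicator (1 : S → ℝ) (ω t).1) = (F t).indicator 1 := by
      funext ω; rfl
    rw [h2, integral_indicator_one hm, measureReal_def] at h
    rw [h]
    simp_rw [← Finset.sum_mul, (hπ t).sum_eq_one, one_mul]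
  simp_rw [hF, ← hacc]
  have hU : M.reachProb B π s = ((M.pathLaw π s) (⋃ t, F t)).toReal := by
    rw [reachProb, measureReal_def]
    congr 2
    ext ω; simp [F]
  rw [hU]
  exact (ENNReal.tendsto_toReal (measure_ne_top _ _)).comp tendsto_measure_iUnion_accumulate

end Law

end MDP

end

noncomputable section

open Filter Topology

namespace MDP

variable {S A : Type*} [Fintype S] [Fintype A] {M : MDP S A} {π : ℕ → S → A → ℝ} {B : Set S}

/-! ### Superharmonic functions and the maximum reachability probability -/

/-- `f` does not increase in expectation, whatever action is taken. -/
def IsSuperharmonic (M : MDP S A) (f : S → ℝ) : Prop := ∀ s, ∀ a ∈ M.act s, M.backup f s a ≤ f s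

lemma IsSuperharmonic.ruleBackup_le {f : S → ℝ} (hf : M.IsSuperharmonic f) {d : S → A → ℝ}
    (hd : M.IsRule d) : M.ruleBackup d f ≤ f :=
  fun s => hd.sum_mul_le (hf s)

lemma IsSuperharmonic.antitone_expVal {f : S → ℝ} (hf : M.IsSuperharmonic f)
    (hπ : π ∈ M.policies) (s : S) : Antitone fun t => M.expVal π s t f :=
  antitone_nat_of_succ_le fun t => by
    rw [expVal_succ]
    exact expVal_mono hπ s t (hf.ruleBackup_le (hπ t))

lemma indicator_le_backup (hB : ∀ s ∈ B, M.IsAbsorbing s) {s : S} {a : A} (ha : a ∈ M.act s) :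
    B.indicator (1 : S → ℝ) s ≤ M.backup (B.indicator 1) s a := by
  by_cases hs : s ∈ B
  · rw [(hB s hs).backup_eq ha]
  · rw [Set.indicator_of_notMem hs]
    exact M.backup_nonneg (Set.indicator_nonneg fun _ _ => zero_le_one) s a

lemma monotone_expVal_indicator (hB : ∀ s ∈ B, M.IsAbsorbing s) (hπ : π ∈ M.policies) (s : S) :
    Monotone fun t => M.expVal π s t (B.indicator 1) :=
  monotone_nat_of_le_succ fun t => by
    rw [expVal_succ]
    refine expVal_mono hπ s t fun s' => ?_
    have h := (hπ t).sum_mul_le (s := s') (g := fun a => -M.backup (B.indicator 1) s' a)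
      fun a ha => neg_le_neg (indicator_le_backup hB ha)
    simp only [mul_neg, Finset.sum_neg_distrib, neg_le_neg_iff] at h
    exact h

/-- The maximum probability of reaching `B` within `n` steps. -/
def horizonReach (M : MDP S A) (hact : ∀ s, (M.act s).Nonempty) (B : Set S) : ℕ → S → ℝ
  | 0 => B.indicator 1
  | n + 1 => fun s => (M.act s).sup' (hact s) (M.backup (horizonReach M hact B n) s)

lemma monotone_horizonReach (hact : ∀ s, (M.act s).Nonempty) (hB : ∀ s ∈ B, M.IsAbsorbing s) :
    Monotone (M.horizonReach hact B) := by
  refine monotone_nat_of_le_succ fun n => ?_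
  induction n with
  | zero =>
    intro s
    obtain ⟨a, ha⟩ := hact s
    exact (indicator_le_backup hB ha).trans (Finset.le_sup' (M.backup (B.indicator 1) s) ha)
  | succ n ih =>
    intro s
    exact Finset.sup'_le (hact s) _ fun a ha => (M.backup_mono ih s a).trans
      (Finset.le_sup' (M.backup (M.horizonReach hact B (n + 1)) s) ha)

section Law

variable [MeasurableSpace S] [DiscreteMeasurableSpace S]
  [MeasurableSpace A] [DiscreteMeasurableSpace A]

lemma expVal_indicator_le_reachProb (hB : ∀ s ∈ B, M.IsAbsorbing s) (hπ : π ∈ M.policies)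
    (s : S) (t : ℕ) : M.expVal π s t (B.indicator 1) ≤ M.reachProb B π s :=
  (monotone_expVal_indicator hB hπ s).ge_of_tendsto (tendsto_reachProb hB hπ s) t

/-- The expectation of `f` decreases in time and dominates that of the indicator. Time `0` gives
minimality of `maxReach`; later times show that maximizing policies conserve it. -/
lemma reachProb_le_expVal (hB : ∀ s ∈ B, M.IsAbsorbing s) {f : S → ℝ} (hf : M.IsSuperharmonic f)
    (hfB : B.indicator 1 ≤ f) (hπ : π ∈ M.policies) (s : S) (t : ℕ) :
    M.reachProb B π s ≤ M.expVal π s t f :=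
  le_of_tendsto (tendsto_reachProb hB hπ s) ((Filter.eventually_ge_atTop t).mono fun n hn =>
    (expVal_mono hπ s n hfB).trans (hf.antitone_expVal hπ s hn))

lemma reachProb_nonneg (M : MDP S A) (B : Set S) (π : ℕ → S → A → ℝ) (s : S) :
    0 ≤ M.reachProb B π s := measureReal_nonneg

lemma reachProb_le_one (hπ : π ∈ M.policies) (s : S) : M.reachProb B π s ≤ 1 := by
  have := isProbabilityMeasure_pathLaw hπ s
  exact measureReal_le_one

lemma reachProb_le_maxReach (hπ : π ∈ M.policies) (s : S) :
    M.reachProb B π s ≤ M.maxReach B s :=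
  le_csSup ⟨1, by rintro _ ⟨π', hπ', rfl⟩; exact reachProb_le_one hπ' s⟩ ⟨π, hπ, rfl⟩

lemma maxReach_nonneg (M : MDP S A) (B : Set S) (s : S) : 0 ≤ M.maxReach B s :=
  Real.sSup_nonneg (by rintro _ ⟨π, -, rfl⟩; exact reachProb_nonneg M B π s)

lemma maxReach_le (hact : ∀ s, (M.act s).Nonempty) {s : S} {m : ℝ}
    (h : ∀ π ∈ M.policies, M.reachProb B π s ≤ m) : M.maxReach B s ≤ m :=
  csSup_le ((policies_nonempty hact).image _) (by rintro _ ⟨π, hπ, rfl⟩; exact h π hπ)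

lemma indicator_le_maxReach (hact : ∀ s, (M.act s).Nonempty) (hB : ∀ s ∈ B, M.IsAbsorbing s) :
    B.indicator 1 ≤ M.maxReach B := fun s => by
  obtain ⟨π, hπ⟩ := policies_nonempty hact
  have h := expVal_indicator_le_reachProb hB hπ s 0
  rw [expVal_zero] at h
  exact h.trans (reachProb_le_maxReach hπ s)

lemma maxReach_le_of_isSuperharmonic (hact : ∀ s, (M.act s).Nonempty)
    (hB : ∀ s ∈ B, M.IsAbsorbing s) {f : S → ℝ} (hf : M.IsSuperharmonic f)
    (hfB : B.indicator 1 ≤ f) : M.maxReach B ≤ f := fun s =>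
  maxReach_le hact fun π hπ => by simpa using reachProb_le_expVal hB hf hfB hπ s 0

/-- Backward induction: a greedy policy reaches `B` within `n` steps with probability
`horizonReach n`, from all states simultaneously. -/
lemma horizonReach_le_maxReach (hact : ∀ s, (M.act s).Nonempty)
    (hB : ∀ s ∈ B, M.IsAbsorbing s) (n : ℕ) : M.horizonReach hact B n ≤ M.maxReach B := by
  intro s
  have hex : ∀ n s, ∃ a ∈ M.act s,
      M.horizonReach hact B (n + 1) s = M.backup (M.horizonReach hact B n) s a := fun n s =>
    Finset.exists_mem_eq_sup' (hact s) _
  choose g hg hg' using hex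
  -- At time `t < n` there are `n - t` steps left, and `g (n - (t + 1))` is greedy for that horizon.
  -- From time `n` on the truncated subtraction just supplies some valid rule.
  let π : ℕ → S → A → ℝ := fun t => detRule (g (n - (t + 1)))
  have hπ : π ∈ M.policies := fun t => (isDetRule_detRule (hg (n - (t + 1)))).1
  have h : ∀ t ≤ n, M.expVal π s t (M.horizonReach hact B (n - t)) =
      M.horizonReach hact B n s := by
    intro t ht
    induction t with
    | zero => simp
    | succ t ih =>
      rw [expVal_succ, ← ih (by omega)]
      congr 1
      funext s'
      rw [ruleBackup, sum_detRule_mul, ← hg', show n - (t + 1) + 1 = n - t by omega]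
  have hn := h n le_rfl
  rw [Nat.sub_self] at hn
  rw [← hn]
  exact (expVal_indicator_le_reachProb hB hπ s n).trans (reachProb_le_maxReach hπ s)

/-- The supremum may use different policies in different states, so it is identified with the limit
of `horizonReach`. That limit is superharmonic by value iteration and lies above the indicator,
hence above `maxReach`; backward induction gives the converse. -/
lemma isSuperharmonic_maxReach (hact : ∀ s, (M.act s).Nonempty)
    (hB : ∀ s ∈ B, M.IsAbsorbing s) : M.IsSuperharmonic (M.maxReach B) := by
  let V := M.horizonReach hact B
  have hbdd : ∀ s, BddAbove (Set.range fun n => V n s) := fun s =>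
    ⟨M.maxReach B s, by rintro _ ⟨n, rfl⟩; exact horizonReach_le_maxReach hact hB n s⟩
  have hlim : ∀ s, Tendsto (fun n => V n s) atTop (𝓝 (⨆ n, V n s)) := fun s =>
    tendsto_atTop_ciSup (fun m n h => monotone_horizonReach hact hB h s) (hbdd s)
  have hW : M.IsSuperharmonic fun s => ⨆ n, V n s := fun s a ha =>
    le_of_tendsto (M.tendsto_backup hlim s a) (Filter.Eventually.of_forall fun n =>
      (Finset.le_sup' (M.backup (V n) s) ha).trans (le_ciSup (hbdd s) (n + 1)))
  have heq : M.maxReach B = fun s => ⨆ n, V n s :=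
    le_antisymm (maxReach_le_of_isSuperharmonic hact hB hW fun s => le_ciSup (hbdd s) 0)
      fun s => ciSup_le fun n => horizonReach_le_maxReach hact hB n s
  rw [heq]
  exact hW

lemma maxReach_eq_one (hact : ∀ s, (M.act s).Nonempty) (hB : ∀ s ∈ B, M.IsAbsorbing s) {s : S}
    (hs : s ∈ B) : M.maxReach B s = 1 := by
  refine le_antisymm (maxReach_le hact fun π hπ => reachProb_le_one hπ s) ?_
  simpa [hs] using indicator_le_maxReach hact hB s

lemma maxReach_eq_zero_iff (hact : ∀ s, (M.act s).Nonempty) {s : S} :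
    M.maxReach B s = 0 ↔ s ∈ M.zeroStates B := by
  refine ⟨fun h π hπ => le_antisymm (h ▸ reachProb_le_maxReach hπ s) (reachProb_nonneg M B π s),
    fun h => le_antisymm (maxReach_le hact fun π hπ => (h π hπ).le) (maxReach_nonneg M B s)⟩

/-! ### Actions that preserve the maximum reachability probability -/

lemma mem_maxAct {s : S} {a : A} :
    a ∈ M.maxAct B s ↔ a ∈ M.act s ∧ M.maxReach B s = M.backup (M.maxReach B) s a :=
  Finset.mem_filter

/-- In an absorbing state every backup is trivial, and where `maxReach` vanishes superharmonicity
forces its backup to vanish. This removes the case distinction in `cleanUp`. -/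
lemma maxAct_eq_act (hact : ∀ s, (M.act s).Nonempty) (hB : ∀ s ∈ B, M.IsAbsorbing s) {s : S}
    (hs : s ∈ B ∪ M.zeroStates B) : M.maxAct B s = M.act s := by
  ext a
  refine ⟨fun h => (mem_maxAct.1 h).1, fun ha => mem_maxAct.2 ⟨ha, ?_⟩⟩
  rcases hs with hs | hs
  · rw [(hB s hs).backup_eq ha]
  · have h0 := (maxReach_eq_zero_iff hact).2 hs
    refine le_antisymm ?_ (isSuperharmonic_maxReach hact hB s a ha)
    rw [h0]
    exact M.backup_nonneg (maxReach_nonneg M B) s a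

/-- In the cleaned-up MDP exactly the actions of `maxAct` are available. -/
lemma cleanUp_act (hact : ∀ s, (M.act s).Nonempty) (hB : ∀ s ∈ B, M.IsAbsorbing s) (s : S) :
    (M.cleanUp B).act s = M.maxAct B s := by
  by_cases h : s ∉ B ∪ M.zeroStates B
  · exact if_pos h
  · exact (if_neg h).trans (maxAct_eq_act hact hB (not_not.1 h)).symm

/-- A set outside `B` on which the maximum reachability probability is a positive constant can be
left by an action of `maxAct`. -/
lemma exists_maxAct_leaving (hact : ∀ s, (M.act s).Nonempty) (hB : ∀ s ∈ B, M.IsAbsorbing s)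
    {C : Set S} (hC : C.Nonempty) (hCB : Disjoint C B) {m : ℝ} (hm : 0 < m)
    (hCm : ∀ s ∈ C, M.maxReach B s = m) :
    ∃ s ∈ C, ∃ a ∈ M.maxAct B s, ∃ s' ∉ C, M.prob s a s' ≠ 0 := by
  classical
  by_contra! hcon
  have hx := isSuperharmonic_maxReach hact hB
  -- Actions outside `maxAct` lose strictly, and there are finitely many of them, so a common gap
  -- `δ` exists.
  obtain ⟨δ, hδ, hδm, hδ0⟩ : ∃ δ : ℝ, (∀ s a, s ∈ C → a ∈ M.act s → a ∉ M.maxAct B s →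
      M.backup (M.maxReach B) s a < m - δ) ∧ δ < m ∧ 0 < δ := by
    have hlim : Tendsto (fun δ : ℝ => m - δ) (𝓝[>] 0) (𝓝 m) := by
      have : ContinuousAt (fun δ : ℝ => m - δ) 0 := by fun_prop
      simpa using this.tendsto.mono_left nhdsWithin_le_nhds
    have h1 : ∀ᶠ δ in 𝓝[>] (0 : ℝ), ∀ s a, s ∈ C → a ∈ M.act s → a ∉ M.maxAct B s →
        M.backup (M.maxReach B) s a < m - δ := by
      rw [eventually_all]; intro s
      rw [eventually_all]; intro a
      by_cases h : s ∈ C ∧ a ∈ M.act s ∧ a ∉ M.maxAct B s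
      · obtain ⟨hs, ha, hna⟩ := h
        have hlt : M.backup (M.maxReach B) s a < m := by
          refine lt_of_le_of_ne (hCm s hs ▸ hx s a ha) fun e => hna (mem_maxAct.2 ⟨ha, ?_⟩)
          rw [hCm s hs, e]
        exact (hlim.eventually_const_lt hlt).mono fun δ h _ _ _ => h
      · exact Eventually.of_forall fun δ h1 h2 h3 => (h ⟨h1, h2, h3⟩).elim
    have h2 : ∀ᶠ δ in 𝓝[>] (0 : ℝ), δ < m :=
      Tendsto.eventually_lt_const hm (tendsto_id.mono_left nhdsWithin_le_nhds)
    exact (h1.and (h2.and self_mem_nhdsWithin)).exists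
  let w : S → ℝ := fun s => if s ∈ C then m - δ else M.maxReach B s
  have hwx : w ≤ M.maxReach B := fun s => by
    by_cases hs : s ∈ C
    · simp only [w, if_pos hs, hCm s hs]; linarith
    · simp only [w, if_neg hs, le_refl]
  -- In `C`, actions of `maxAct` stay in `C`, where `w` is constant, and the others lose at least
  -- `δ`. Outside `C` only the backup is lowered.
  have hw : M.IsSuperharmonic w := by
    intro s a ha
    by_cases hs : s ∈ C
    · simp only [w, if_pos hs]
      by_cases hmax : a ∈ M.maxAct B s
      · refine ((M.backup_congr (g := fun _ => m - δ) fun s' hp => ?_).trans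
          (M.backup_const ha _)).le
        exact if_pos (not_imp_comm.1 (hcon s hs a hmax s') hp)
      · exact (M.backup_mono hwx s a).trans (hδ s a hs ha hmax).le
    · simp only [w, if_neg hs]
      exact (M.backup_mono hwx s a).trans (hx s a ha)
  have hwB : B.indicator 1 ≤ w := fun s => by
    by_cases hs : s ∈ C
    · rw [Set.indicator_of_notMem (Set.disjoint_left.1 hCB hs)]
      simp only [w, if_pos hs]; linarith
    · simp only [w, if_neg hs]
      exact indicator_le_maxReach hact hB s
  obtain ⟨s, hs⟩ := hC
  have h := maxReach_le_of_isSuperharmonic hact hB hw hwB s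
  simp only [w, if_pos hs, hCm s hs] at h
  linarith

/-- Outside `B` and the zero states, a singleton is a set to which `exists_maxAct_leaving` applies.
-/
lemma maxAct_nonempty (hact : ∀ s, (M.act s).Nonempty) (hB : ∀ s ∈ B, M.IsAbsorbing s) (s : S) :
    (M.maxAct B s).Nonempty := by
  by_cases hs : s ∈ B ∪ M.zeroStates B
  · rw [maxAct_eq_act hact hB hs]
    exact hact s
  · have hpos : 0 < M.maxReach B s := (maxReach_nonneg M B s).lt_of_ne fun h =>
      hs (Or.inr ((maxReach_eq_zero_iff hact).1 h.symm))
    obtain ⟨s₁, rfl, a, ha, -⟩ := exists_maxAct_leaving hact hB (Set.singleton_nonempty s)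
      (Set.disjoint_singleton_left.2 fun h => hs (Or.inl h)) hpos
      (fun s' (hs' : s' = s) => by rw [hs'])
    exact ⟨a, ha⟩

/-! ### Policies attaining the maximum reachability probability -/

lemma isRule_of_isRule_cleanUp (hact : ∀ s, (M.act s).Nonempty)
    (hB : ∀ s ∈ B, M.IsAbsorbing s) {d : S → A → ℝ} (hd : (M.cleanUp B).IsRule d) :
    M.IsRule d := by
  intro s
  have hsub : ∀ a, a ∉ M.act s → d s a = 0 := fun a ha => hd.eq_zero fun h => ha <| by
    rw [cleanUp_act hact hB] at h
    exact (mem_maxAct.1 h).1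
  refine ⟨hd.nonneg s, hsub, ?_⟩
  rw [Finset.sum_subset (Finset.subset_univ _) fun a _ => hsub a]
  exact hd.sum_eq_one s

/-- A stationary policy of the cleaned-up MDP that uses all actions of `maxAct` reaches `B` with
maximum probability, from every state. -/
lemma reachProb_stationary_eq_maxReach (hact : ∀ s, (M.act s).Nonempty)
    (hB : ∀ s ∈ B, M.IsAbsorbing s) {d : S → A → ℝ} (hd : (M.cleanUp B).IsRule d)
    (hpos : ∀ s, ∀ a ∈ M.maxAct B s, 0 < d s a) (s : S) :
    M.reachProb B (stationary d) s = M.maxReach B s := by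
  have hdM := isRule_of_isRule_cleanUp hact hB hd
  have hπ : stationary d ∈ M.policies := fun _ => hdM
  have hmax : ∀ {s a}, d s a ≠ 0 → a ∈ M.maxAct B s := fun h => by
    rw [← cleanUp_act hact hB]; exact hd.mem_act h
  set y : S → ℝ := M.reachProb B (stationary d) with hy
  set x := M.maxReach B with hx
  have hlim : ∀ s, Tendsto (fun t => (M.ruleBackup d)^[t] (B.indicator 1) s) atTop (𝓝 (y s)) :=
    fun s => (tendsto_reachProb hB hπ s).congr fun t => expVal_stationary M d s t _
  have hTy : M.ruleBackup d y = y := by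
    funext s
    have h1 : Tendsto (fun t => M.ruleBackup d ((M.ruleBackup d)^[t] (B.indicator 1)) s) atTop
        (𝓝 (M.ruleBackup d y s)) :=
      tendsto_finsetSum _ fun a _ => (M.tendsto_backup hlim s a).const_mul _
    exact tendsto_nhds_unique h1 (((tendsto_add_atTop_iff_nat 1).2 (hlim s)).congr fun t => by
      rw [Function.iterate_succ_apply'])
  have hTx : M.ruleBackup d x = x := by
    funext s
    calc M.ruleBackup d x s = ∑ a, d s a * x s := by
          refine Finset.sum_congr rfl fun a _ => ?_
          by_cases h0 : d s a = 0
          · simp [h0]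
          · rw [← (mem_maxAct.1 (hmax h0)).2]
      _ = x s := by rw [← Finset.sum_mul, hdM.sum_eq_one, one_mul]
  obtain ⟨s₀, -, hs₀⟩ := Finset.exists_max_image Finset.univ (x - y) ⟨s, Finset.mem_univ s⟩
  set m := (x - y) s₀ with hm
  have hle : ∀ s, (x - y) s ≤ m := fun s => hs₀ s (Finset.mem_univ s)
  refine le_antisymm (reachProb_le_maxReach hπ s) ?_
  by_contra! hlt
  have hmpos : 0 < m := (sub_pos.2 hlt).trans_le (hle s)
  let C : Set S := {s | (x - y) s = m}
  -- Maximum principle: `x - y` is harmonic for `d`, so where it is maximal every successor under an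
  -- action of positive weight is again a maximum point.
  have hclosed : ∀ s ∈ C, ∀ a ∈ M.maxAct B s, ∀ s' ∉ C, M.prob s a s' = 0 := by
    intro s hs a ha s' hs'
    have hu : M.ruleBackup d (x - y) s = m := by
      rw [ruleBackup_sub, hTx, hTy]; exact hs
    have h1 : ∑ a, d s a * (m - M.backup (x - y) s a) = 0 := by
      simp only [mul_sub, Finset.sum_sub_distrib, ← Finset.sum_mul, hdM.sum_eq_one, one_mul]
      exact sub_eq_zero.2 hu.symm
    have h1' : ∀ a, 0 ≤ d s a * (m - M.backup (x - y) s a) := fun a => by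
      by_cases h0 : d s a = 0
      · simp [h0]
      · exact mul_nonneg (hdM.nonneg s a) (sub_nonneg.2 (M.backup_le hle (hdM.mem_act h0)))
    have h2 := (Finset.sum_eq_zero_iff_of_nonneg fun a _ => h1' a).1 h1 a (Finset.mem_univ a)
    have h3 : m - M.backup (x - y) s a = 0 :=
      (mul_eq_zero.1 h2).resolve_left (hpos s a ha).ne'
    have h4 : ∑ s', M.prob s a s' * (m - (x - y) s') = 0 := by
      simp only [mul_sub, Finset.sum_sub_distrib]
      rw [← h3]
      congr 1
      exact M.backup_const (mem_maxAct.1 ha).1 m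
    have h5 := (Finset.sum_eq_zero_iff_of_nonneg fun s' _ =>
      mul_nonneg (M.prob_nonneg s a s') (sub_nonneg.2 (hle s'))).1 h4 s' (Finset.mem_univ s')
    exact (mul_eq_zero.1 h5).resolve_right fun h => hs' (sub_eq_zero.1 h).symm
  have hCB : Disjoint C B := Set.disjoint_left.2 fun s (hs : x s - y s = m) hsB => by
    have h1 : x s = 1 := maxReach_eq_one hact hB hsB
    have h2 := expVal_indicator_le_reachProb hB hπ s 0
    rw [expVal_zero, Set.indicator_of_mem hsB, Pi.one_apply] at h2
    change 1 ≤ y s at h2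
    linarith
  have hy0 : ∀ s ∈ C, y s = 0 := by
    intro s hs
    have h : ∀ t, ∀ s ∈ C, (M.ruleBackup d)^[t] (B.indicator 1) s = 0 := by
      intro t
      induction t with
      | zero => exact fun s hs => Set.indicator_of_notMem (Set.disjoint_left.1 hCB hs) _
      | succ t ih =>
        intro s hs
        rw [Function.iterate_succ_apply']
        refine Finset.sum_eq_zero fun a _ => ?_
        by_cases h0 : d s a = 0
        · simp [h0]
        · rw [backup, Finset.sum_eq_zero, mul_zero]
          intro s' _
          by_cases hs' : s' ∈ C
          · rw [ih s' hs', mul_zero]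
          · rw [hclosed s hs a (hmax h0) s' hs', zero_mul]
    refine tendsto_nhds_unique (hlim s) ?_
    simp only [h _ s hs, tendsto_const_nhds]
  obtain ⟨s₁, hs₁, a, ha, s', hs', hp⟩ := exists_maxAct_leaving hact hB (C := C) ⟨s₀, rfl⟩ hCB
    hmpos fun s hs => by
      have h : x s - y s = m := hs
      rw [hy0 s hs, sub_zero] at h
      exact h
  exact hp (hclosed s₁ hs₁ a ha s' hs')

/-- A policy that reaches `B` with maximum probability uses only actions of `maxAct` in the states
that it visits. -/
lemma mem_maxAct_of_reachProb_eq (hact : ∀ s, (M.act s).Nonempty)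
    (hB : ∀ s ∈ B, M.IsAbsorbing s) (hπ : π ∈ M.policies) {s : S}
    (h : M.reachProb B π s = M.maxReach B s) {t : ℕ} {s' : S} {a : A}
    (hne : M.occ π s t s' * π t s' a ≠ 0) : a ∈ M.maxAct B s' := by
  have hx := isSuperharmonic_maxReach hact hB
  -- Squeezed between the starting value and the reachability probability. The nonnegative one-step
  -- losses then have mean zero, so each loss of positive weight vanishes.
  have hE : ∀ t, M.expVal π s t (M.maxReach B) = M.maxReach B s := fun t =>
    le_antisymm (by simpa using hx.antitone_expVal hπ s (Nat.zero_le t))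
      (h ▸ reachProb_le_expVal hB hx (indicator_le_maxReach hact hB) hπ s t)
  have h0 : M.expVal π s t (M.maxReach B - M.ruleBackup (π t) (M.maxReach B)) = 0 := by
    rw [expVal_sub, ← expVal_succ, hE, hE, sub_self]
  have h1 := (Finset.sum_eq_zero_iff_of_nonneg fun s' _ => mul_nonneg (occ_nonneg hπ s t s')
    (sub_nonneg.2 (hx.ruleBackup_le (hπ t) s'))).1 h0 s' (Finset.mem_univ s')
  have h2 : M.maxReach B s' - M.ruleBackup (π t) (M.maxReach B) s' = 0 :=
    (mul_eq_zero.1 h1).resolve_left (left_ne_zero_of_mul hne)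
  have h3 : ∑ a, π t s' a * (M.maxReach B s' - M.backup (M.maxReach B) s' a) = 0 := by
    simp only [mul_sub, Finset.sum_sub_distrib, ← Finset.sum_mul, (hπ t).sum_eq_one, one_mul]
    exact h2
  have h3' : ∀ a, 0 ≤ π t s' a * (M.maxReach B s' - M.backup (M.maxReach B) s' a) := fun a => by
    by_cases h0 : π t s' a = 0
    · simp [h0]
    · exact mul_nonneg ((hπ t).nonneg s' a) (sub_nonneg.2 (hx s' a ((hπ t).mem_act h0)))
  have h4 := (Finset.sum_eq_zero_iff_of_nonneg fun a _ => h3' a).1 h3 a (Finset.mem_univ a)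
  refine mem_maxAct.2 ⟨(hπ t).mem_act (right_ne_zero_of_mul hne), sub_eq_zero.1 ?_⟩
  exact (mul_eq_zero.1 h4).resolve_left (right_ne_zero_of_mul hne)

end Law

end MDP

end

noncomputable section

open Filter Topology

namespace MDP

variable {S A : Type*} [Fintype S] [Fintype A] {M : MDP S A} {B : Set S} {c : S → A → ℝ} {β : ℝ}

/-! ### Discounted costs -/

/-- A bounded sequence with `E t ≤ C t + β * E (t + 1)` starts below the discounted sum of `C`. -/
lemma le_of_hasSum_discounted (hβ0 : 0 ≤ β) (hβ1 : β < 1) {C E : ℕ → ℝ} {J K : ℝ}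
    (hJ : HasSum (fun t => β ^ t * C t) J) (hK : ∀ t, |E t| ≤ K)
    (hle : ∀ t, E t ≤ C t + β * E (t + 1)) : E 0 ≤ J := by
  -- The left side telescopes, and boundedness of `E` makes the remainder vanish.
  have h1 : ∀ n, E 0 - β ^ n * E n ≤ ∑ t ∈ Finset.range n, β ^ t * C t := by
    intro n
    have h := Finset.sum_range_sub' (fun t => β ^ t * E t) n
    rw [pow_zero, one_mul] at h
    rw [← h]
    refine Finset.sum_le_sum fun t _ => ?_
    have := mul_le_mul_of_nonneg_left (hle t) (pow_nonneg hβ0 t)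
    rw [pow_succ]
    linarith
  have h2 : Tendsto (fun n => β ^ n * E n) atTop (𝓝 0) := by
    refine squeeze_zero_norm (a := fun n => β ^ n * K) (fun n => ?_) ?_
    · rw [norm_mul, norm_pow, Real.norm_of_nonneg hβ0]
      exact mul_le_mul_of_nonneg_left (hK n) (pow_nonneg hβ0 n)
    · simpa using (tendsto_pow_atTop_nhds_zero_of_lt_one hβ0 hβ1).mul_const K
  have h3 : Tendsto (fun n => E 0 - β ^ n * E n) atTop (𝓝 (E 0)) := by
    simpa using h2.const_sub (E 0)
  exact le_of_tendsto_of_tendsto' h3 hJ.tendsto_sum_nat h1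

section Law

variable [MeasurableSpace S] [DiscreteMeasurableSpace S]
  [MeasurableSpace A] [DiscreteMeasurableSpace A]

/-- A solution of the Bellman inequality, for the actions that `π` actually takes, is a lower bound
for the cost of `π`. -/
lemma le_cost (hβ0 : 0 ≤ β) (hβ1 : β < 1) {π : ℕ → S → A → ℝ} (hπ : π ∈ M.policies) {v : S → ℝ}
    (h : ∀ t s a, M.occ π M.init t s * π t s a ≠ 0 → v s ≤ c s a + β * M.backup v s a) :
    v M.init ≤ M.cost c β π := by
  obtain ⟨K, hK⟩ := (Set.finite_range fun s => |v s|).bddAbove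
  have hK' : ∀ s, |v s| ≤ K := fun s => hK ⟨s, rfl⟩
  have := le_of_hasSum_discounted hβ0 hβ1 (E := fun t => M.expVal π M.init t v)
    (hasSum_cost hπ c hβ0 hβ1) (fun t => abs_expVal_le hπ M.init t hK') fun t => by
      rw [expVal_succ, expVal, expVal, expVal, Finset.mul_sum, ← Finset.sum_add_distrib]
      refine Finset.sum_le_sum fun s _ => ?_
      have h1 : M.occ π M.init t s * v s = ∑ a, M.occ π M.init t s * π t s a * v s := by
        rw [← Finset.sum_mul, ← Finset.mul_sum, (hπ t).sum_eq_one, mul_one]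
      rw [h1, ruleBackup, Finset.mul_sum, Finset.mul_sum, Finset.mul_sum,
        ← Finset.sum_add_distrib]
      refine Finset.sum_le_sum fun a _ => ?_
      by_cases h0 : M.occ π M.init t s * π t s a = 0
      · rcases mul_eq_zero.1 h0 with h0 | h0 <;> simp [h0]
      · have h2 := mul_le_mul_of_nonneg_left (h t s a h0)
          (mul_nonneg (occ_nonneg hπ M.init t s) ((hπ t).nonneg s a))
        linarith
  simpa using this

/-- The cost of a stationary policy is given by the solution of its evaluation equation. -/
lemma cost_stationary_eq (hβ0 : 0 ≤ β) (hβ1 : β < 1) {d : S → A → ℝ} (hd : M.IsRule d)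
    {v : S → ℝ} (hv : ∀ s, v s = ∑ a, d s a * c s a + β * M.ruleBackup d v s) :
    M.cost c β (stationary d) = v M.init := by
  have hπ : stationary d ∈ M.policies := fun _ => hd
  obtain ⟨K, hK⟩ := (Set.finite_range fun s => |v s|).bddAbove
  have hK' : ∀ s, |v s| ≤ K := fun s => hK ⟨s, rfl⟩
  have hsum := hasSum_cost hπ c hβ0 hβ1
  have heq : ∀ t, M.expVal (stationary d) M.init t v =
      (M.expVal (stationary d) M.init t fun s => ∑ a, stationary d t s a * c s a) +
        β * M.expVal (stationary d) M.init (t + 1) v := fun t => by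
    rw [expVal_succ, expVal, expVal, expVal, Finset.mul_sum, ← Finset.sum_add_distrib]
    refine Finset.sum_congr rfl fun s _ => ?_
    rw [hv s, stationary]
    ring
  have h1 := le_of_hasSum_discounted hβ0 hβ1 (E := fun t => M.expVal (stationary d) M.init t v)
    hsum (fun t => abs_expVal_le hπ M.init t hK') fun t => (heq t).le
  have h2 := le_of_hasSum_discounted hβ0 hβ1
    (E := fun t => -M.expVal (stationary d) M.init t v)
    (C := fun t => -M.expVal (stationary d) M.init t fun s => ∑ a, stationary d t s a * c s a)
    (by simpa only [mul_neg] using hsum.neg)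
    (fun t => by rw [abs_neg]; exact abs_expVal_le hπ M.init t hK')
    fun t => by linarith [heq t]
  simp only [expVal_zero] at h1 h2
  linarith

end Law

/-- The Bellman equation of the discounted problem has a solution, together with a rule that
attains the minima. -/
lemma exists_bellman_solution (hact : ∀ s, (M.act s).Nonempty) (c : S → A → ℝ) (hβ0 : 0 ≤ β)
    (hβ1 : β < 1) : ∃ (v : S → ℝ) (f : S → A), (∀ s, f s ∈ M.act s) ∧
      (∀ s, v s = c s (f s) + β * M.backup v s (f s)) ∧
      ∀ s, ∀ a ∈ M.act s, v s ≤ c s a + β * M.backup v s a := by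
  let T : (S → ℝ) → S → ℝ := fun v s =>
    (M.act s).inf' (hact s) fun a => c s a + β * M.backup v s a
  have hle : ∀ v w s, T v s ≤ T w s + β * dist v w := by
    intro v w s
    obtain ⟨a, ha, hw⟩ := Finset.exists_mem_eq_inf' (hact s) fun a => c s a + β * M.backup w s a
    have h1 : T v s ≤ c s a + β * M.backup v s a := Finset.inf'_le _ ha
    have h2 : M.backup (v - w) s a ≤ dist v w := M.backup_le (fun s' =>
      (le_abs_self _).trans (by simpa [Real.dist_eq] using dist_le_pi_dist v w s')) ha
    rw [backup_sub] at h2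
    have h3 := mul_le_mul_of_nonneg_left h2 hβ0
    have h4 : T w s = c s a + β * M.backup w s a := hw
    linarith
  have hT : ContractingWith ⟨β, hβ0⟩ T := by
    refine ⟨hβ1, LipschitzWith.of_dist_le_mul fun v w => ?_⟩
    refine (dist_pi_le_iff (mul_nonneg hβ0 dist_nonneg)).2 fun s => ?_
    rw [Real.dist_eq, abs_sub_le_iff]
    have h1 := hle v w s
    have h2 := hle w v s
    rw [dist_comm w v] at h2
    exact ⟨sub_le_iff_le_add'.2 h1, sub_le_iff_le_add'.2 h2⟩
  let v := hT.fixedPoint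
  have hv : T v = v := hT.fixedPoint_isFixedPt
  choose f hf hf' using fun s =>
    Finset.exists_mem_eq_inf' (hact s) fun a => c s a + β * M.backup v s a
  refine ⟨v, f, hf, fun s => ?_, fun s a ha => ?_⟩
  · rw [← hf' s]; exact (congrFun hv s).symm
  · exact (congrFun hv s).symm.le.trans (Finset.inf'_le _ ha)

/-! ### The resolvent of a stationary policy -/

lemma chainMatrix_mulVec {d : S → A → ℝ} (hd : M.IsRule d) (f : S → ℝ) :
    M.chainMatrix d *ᵥ f = M.ruleBackup d f := by
  funext s
  simp only [Matrix.mulVec, dotProduct, chainMatrix, Matrix.of_apply, ruleBackup,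
    hd.sum_act_mul, backup, Finset.sum_mul, Finset.mul_sum]
  rw [Finset.sum_comm]
  simp only [mul_assoc]

open Classical in
-- Strict diagonal dominance: with stochastic rows, `β * (1 - P s s) < 1 - β * P s s`.
lemma det_one_sub_smul_chainMatrix_ne_zero {d : S → A → ℝ} (hd : M.IsRule d) (hβ0 : 0 ≤ β)
    (hβ1 : β < 1) : (1 - β • M.chainMatrix d).det ≠ 0 := by
  refine det_ne_zero_of_sum_row_lt_diag fun s => ?_
  have h0 : ∀ s', 0 ≤ M.chainMatrix d s s' := fun s' =>
    Finset.sum_nonneg fun a _ => mul_nonneg (hd.nonneg s a) (M.prob_nonneg _ _ _)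
  have h1 : ∑ s', M.chainMatrix d s s' = 1 := by
    have h := congrFun (chainMatrix_mulVec hd fun _ => 1) s
    simp only [Matrix.mulVec, dotProduct, mul_one] at h
    rw [h, ruleBackup, ← hd.sum_act_mul,
      Finset.sum_congr rfl fun a ha => by rw [M.backup_const ha], ← Finset.sum_mul,
      (hd s).2.2, one_mul]
  have h2 : ∑ s' ∈ Finset.univ.erase s, ‖(1 - β • M.chainMatrix d) s s'‖ =
      β * ∑ s' ∈ Finset.univ.erase s, M.chainMatrix d s s' := by
    rw [Finset.mul_sum]
    refine Finset.sum_congr rfl fun s' hs' => ?_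
    rw [Matrix.sub_apply, Matrix.one_apply_ne (Finset.ne_of_mem_erase hs').symm, zero_sub,
      norm_neg, Matrix.smul_apply, smul_eq_mul, Real.norm_of_nonneg (mul_nonneg hβ0 (h0 s'))]
  rw [← Finset.add_sum_erase _ _ (Finset.mem_univ s)] at h1
  have h3 : M.chainMatrix d s s ≤ 1 := by
    have := Finset.sum_nonneg fun s' (_ : s' ∈ Finset.univ.erase s) => h0 s'
    linarith
  rw [h2, Matrix.sub_apply, Matrix.one_apply_eq, Matrix.smul_apply, smul_eq_mul]
  refine lt_of_lt_of_le ?_ (le_abs_self _)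
  rw [← eq_sub_iff_add_eq'] at h1
  rw [h1]
  linarith

section Law

variable [MeasurableSpace S] [DiscreteMeasurableSpace S]
  [MeasurableSpace A] [DiscreteMeasurableSpace A]

lemma costVec_eq {d : S → A → ℝ} (h : ∀ s, ∀ a ∉ M.maxAct B s, d s a = 0) (s : S) :
    M.costVec B c d s = ∑ a, d s a * c s a :=
  Finset.sum_subset (Finset.subset_univ _) fun a _ ha => by rw [h s a ha, zero_mul]

lemma eq_zero_of_isRule_cleanUp (hact : ∀ s, (M.act s).Nonempty)
    (hB : ∀ s ∈ B, M.IsAbsorbing s) {d : S → A → ℝ} (hd : (M.cleanUp B).IsRule d) (s : S) :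
    ∀ a ∉ M.maxAct B s, d s a = 0 := fun a ha => hd.eq_zero (by rwa [cleanUp_act hact hB])

open Classical in
/-- The cost of a stationary policy of the cleaned-up MDP in terms of its resolvent. -/
lemma cost_stationary_eq_dotProduct (hact : ∀ s, (M.act s).Nonempty)
    (hB : ∀ s ∈ B, M.IsAbsorbing s) (hβ0 : 0 ≤ β) (hβ1 : β < 1) {d : S → A → ℝ}
    (hd : (M.cleanUp B).IsRule d) :
    M.cost c β (stationary d) =
      Pi.single M.init 1 ⬝ᵥ ((1 - β • M.chainMatrix d)⁻¹ *ᵥ M.costVec B c d) := by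
  have hdM := isRule_of_isRule_cleanUp hact hB hd
  rw [single_one_dotProduct]
  refine cost_stationary_eq hβ0 hβ1 hdM fun s => ?_
  set v := (1 - β • M.chainMatrix d)⁻¹ *ᵥ M.costVec B c d with hv
  have h : (1 - β • M.chainMatrix d) *ᵥ v = M.costVec B c d := by
    rw [hv, Matrix.mulVec_mulVec, Matrix.mul_nonsing_inv _
      (det_one_sub_smul_chainMatrix_ne_zero hdM hβ0 hβ1).isUnit, Matrix.one_mulVec]
  have hs := congrFun h s
  rw [Matrix.sub_mulVec, Matrix.one_mulVec, Matrix.smul_mulVec, chainMatrix_mulVec hdM,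
    costVec_eq (eq_zero_of_isRule_cleanUp hact hB hd)] at hs
  simp only [Pi.sub_apply, Pi.smul_apply, smul_eq_mul] at hs
  linarith

/-! ### The perturbed rule -/

lemma perturb_eq_zero {d : S → A → ℝ} {e : ℝ} {s : S} {a : A} (ha : a ∉ M.maxAct B s) :
    M.perturb B d e s a = 0 := by
  classical
  rw [perturb, if_neg fun h => ha (by rw [unusedAct, Finset.mem_sdiff] at h; exact h.1),
    if_neg fun h : a ∈ M.usedAct B d s => ha (Finset.mem_filter.1 h).1]

/-- Averages with respect to the perturbed rule. -/
lemma sum_perturb_mul (hact : ∀ s, (M.act s).Nonempty) (hB : ∀ s ∈ B, M.IsAbsorbing s)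
    {d : S → A → ℝ} (hd : (M.cleanUp B).IsRule d) (e : ℝ) (s : S) (g : A → ℝ) :
    ∑ a, M.perturb B d e s a * g a = ∑ a, d s a * g a +
      e * (∑ a ∈ M.unusedAct B d s, g a -
        M.actRatio B d s * ∑ a ∈ M.usedAct B d s, g a) := by
  classical
  have h : ∀ a, M.perturb B d e s a = d s a + ((if a ∈ M.unusedAct B d s then e else 0) -
      (if a ∈ M.usedAct B d s then e * M.actRatio B d s else 0)) := by
    intro a
    rw [perturb]
    by_cases h1 : a ∈ M.unusedAct B d s
    · have h2 : a ∈ M.maxAct B s ∧ a ∉ M.usedAct B d s := by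
        simpa only [unusedAct, Finset.mem_sdiff] using h1
      have h3 : d s a = 0 := le_antisymm
        (not_lt.1 fun h => h2.2 (Finset.mem_filter.2 ⟨h2.1, h⟩)) (hd.nonneg s a)
      simp [h1, h2.2, h3]
    · by_cases h2 : a ∈ M.usedAct B d s
      · simp [h1, h2, sub_eq_add_neg]
      · have h3 : a ∉ M.maxAct B s := fun h => h1 (by
          rw [unusedAct, Finset.mem_sdiff]; exact ⟨h, h2⟩)
        simp [h1, h2, eq_zero_of_isRule_cleanUp hact hB hd s a h3]
  simp_rw [h, add_mul, sub_mul, Finset.sum_add_distrib, Finset.sum_sub_distrib, ite_mul, zero_mul,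
    Finset.sum_ite_mem, Finset.univ_inter, ← Finset.mul_sum]
  ring

lemma chainMatrix_perturb (hact : ∀ s, (M.act s).Nonempty) (hB : ∀ s ∈ B, M.IsAbsorbing s)
    {d : S → A → ℝ} (hd : (M.cleanUp B).IsRule d) (e : ℝ) :
    M.chainMatrix (M.perturb B d e) = M.chainMatrix d + e • M.pertMatrix B d := by
  ext s s'
  simp only [chainMatrix, pertMatrix, Matrix.of_apply, Matrix.add_apply, Matrix.smul_apply,
    smul_eq_mul, (isRule_of_isRule_cleanUp hact hB hd).sum_act_mul]
  rw [← sum_perturb_mul hact hB hd]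
  exact Finset.sum_subset (Finset.subset_univ _) fun a _ ha => by
    rw [perturb_eq_zero fun h => ha (mem_maxAct.1 h).1, zero_mul]

lemma costVec_perturb (hact : ∀ s, (M.act s).Nonempty) (hB : ∀ s ∈ B, M.IsAbsorbing s)
    {d : S → A → ℝ} (hd : (M.cleanUp B).IsRule d) (e : ℝ) :
    M.costVec B c (M.perturb B d e) = M.costVec B c d + e • M.pertVec B c d := by
  funext s
  rw [Pi.add_apply, Pi.smul_apply, costVec_eq fun s a ha => perturb_eq_zero ha,
    costVec_eq (eq_zero_of_isRule_cleanUp hact hB hd), sum_perturb_mul hact hB hd]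
  rfl

lemma isRule_perturb (hact : ∀ s, (M.act s).Nonempty) (hB : ∀ s ∈ B, M.IsAbsorbing s)
    {d : S → A → ℝ} (hd : (M.cleanUp B).IsDetRule d) {e : ℝ}
    (hpos : ∀ s, ∀ a ∈ M.maxAct B s, 0 < M.perturb B d e s a) :
    (M.cleanUp B).IsRule (M.perturb B d e) := by
  have hzero : ∀ s a, a ∉ (M.cleanUp B).act s → M.perturb B d e s a = 0 := fun s a ha =>
    perturb_eq_zero (by rwa [← cleanUp_act hact hB])
  intro s
  refine ⟨fun a => ?_, hzero s, ?_⟩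
  · by_cases ha : a ∈ M.maxAct B s
    · exact (hpos s a ha).le
    · exact (perturb_eq_zero ha).ge
  · obtain ⟨a, ha, hda⟩ := hd.2 s
    -- A used action exists, so `actRatio` is a genuine quotient and the added and removed weights
    -- cancel.
    have hcard : ((M.usedAct B d s).card : ℝ) ≠ 0 := by
      refine Nat.cast_ne_zero.2 (Finset.card_ne_zero_of_mem (a := a) ?_)
      refine Finset.mem_filter.2 ⟨by rwa [← cleanUp_act hact hB], ?_⟩
      rw [hda]; exact one_pos
    rw [Finset.sum_subset (Finset.subset_univ _) fun a _ => hzero s a]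
    have h := sum_perturb_mul hact hB hd.1 e s fun _ => 1
    simp only [mul_one, hd.1.sum_eq_one, Finset.sum_const, nsmul_eq_mul, actRatio,
      div_mul_cancel₀ _ hcard, sub_self, mul_zero, add_zero] at h
    exact h

/-- The increase of the cost caused by the perturbation. -/
lemma cost_perturb_sub_cost (hact : ∀ s, (M.act s).Nonempty) (hB : ∀ s ∈ B, M.IsAbsorbing s)
    (hβ0 : 0 ≤ β) (hβ1 : β < 1) {d : S → A → ℝ} (hd : (M.cleanUp B).IsRule d) {e : ℝ}
    (he : (M.cleanUp B).IsRule (M.perturb B d e)) :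
    M.cost c β (stationary (M.perturb B d e)) - M.cost c β (stationary d) =
      e * (M.gamma1 B c β d e + M.gamma2 B c β d e) := by
  classical
  rw [cost_stationary_eq_dotProduct hact hB hβ0 hβ1 hd,
    cost_stationary_eq_dotProduct hact hB hβ0 hβ1 he, costVec_perturb hact hB hd, gamma1, gamma2]
  have hu := (det_one_sub_smul_chainMatrix_ne_zero (isRule_of_isRule_cleanUp hact hB hd)
    hβ0 hβ1).isUnit
  have hu' := (det_one_sub_smul_chainMatrix_ne_zero (isRule_of_isRule_cleanUp hact hB he)
    hβ0 hβ1).isUnit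
  have hP : 1 - β • M.chainMatrix (M.perturb B d e) =
      1 - β • M.chainMatrix d - (β * e) • M.pertMatrix B d := by
    rw [chainMatrix_perturb hact hB hd, smul_add, smul_smul, sub_add_eq_sub_sub]
  set R := 1 - β • M.chainMatrix d
  set R' := 1 - β • M.chainMatrix (M.perturb B d e)
  -- Resolvent identity, from `R = R' + (β * e) • M.pertMatrix B d`.
  have hinv : R'⁻¹ = R⁻¹ + (β * e) • (R⁻¹ * M.pertMatrix B d * R'⁻¹) := by
    have h1 : M.pertMatrix B d * R'⁻¹ * R' = M.pertMatrix B d := by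
      rw [mul_assoc, Matrix.nonsing_inv_mul _ hu', mul_one]
    have h2 : (R⁻¹ + (β * e) • (R⁻¹ * M.pertMatrix B d * R'⁻¹)) * R' = 1 := by
      rw [add_mul, smul_mul_assoc, mul_assoc R⁻¹, mul_assoc R⁻¹, h1, ← mul_smul_comm, ← mul_add,
        hP, sub_add_cancel, Matrix.nonsing_inv_mul _ hu]
    exact Matrix.inv_eq_left_inv h2
  rw [Matrix.mulVec_add, Matrix.mulVec_smul, dotProduct_add, dotProduct_smul]
  -- Only the resolvent applied to the unperturbed costs is expanded; those in `γ₁` and `γ₂` must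
  -- stay.
  nth_rw 1 [hinv]
  rw [Matrix.add_mulVec, Matrix.smul_mulVec, dotProduct_add, dotProduct_smul]
  simp only [smul_eq_mul]
  ring

/-- The perturbed matrix is affine in `e` and invertible at `e = 0`; its inverse is the adjugate
divided by the determinant. -/
lemma continuousAt_gamma (hact : ∀ s, (M.act s).Nonempty) (hB : ∀ s ∈ B, M.IsAbsorbing s)
    (hβ0 : 0 ≤ β) (hβ1 : β < 1) {d : S → A → ℝ} (hd : (M.cleanUp B).IsRule d) :
    ContinuousAt (fun e => M.gamma1 B c β d e + M.gamma2 B c β d e) 0 := by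
  classical
  have hdet := det_one_sub_smul_chainMatrix_ne_zero (isRule_of_isRule_cleanUp hact hB hd) hβ0 hβ1
  have hinv : ContinuousAt (fun e => (1 - β • M.chainMatrix (M.perturb B d e))⁻¹) 0 := by
    simp_rw [chainMatrix_perturb hact hB hd, Matrix.inv_def, Ring.inverse_eq_inv']
    have hc : Continuous fun e : ℝ => 1 - β • (M.chainMatrix d + e • M.pertMatrix B d) := by
      fun_prop
    exact (hc.matrix_det.continuousAt.inv₀ (by simpa using hdet)).smul
      hc.matrix_adjugate.continuousAt
  have h1 : Continuous fun X : Matrix S S ℝ =>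
      β * (Pi.single M.init 1 ⬝ᵥ
        (((1 - β • M.chainMatrix d)⁻¹ * M.pertMatrix B d * X) *ᵥ M.costVec B c d)) +
      Pi.single M.init 1 ⬝ᵥ (X *ᵥ M.pertVec B c d) := by
    have h2 : Continuous fun X : Matrix S S ℝ =>
        ((1 - β • M.chainMatrix d)⁻¹ * M.pertMatrix B d * X) *ᵥ M.costVec B c d :=
      (continuous_const.matrix_mul continuous_id).matrix_mulVec continuous_const
    have h3 : Continuous fun X : Matrix S S ℝ => X *ᵥ M.pertVec B c d :=
      continuous_id.matrix_mulVec continuous_const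
    exact (continuous_const.mul (continuous_const.dotProduct h2)).add
      (continuous_const.dotProduct h3)
  exact h1.continuousAt.comp hinv

lemma eventually_perturb_pos {d : S → A → ℝ} :
    ∀ᶠ e in 𝓝[>] (0 : ℝ), ∀ s, ∀ a ∈ M.maxAct B s, 0 < M.perturb B d e s a := by
  classical
  rw [eventually_all]; intro s
  rw [eventually_all]; intro a
  by_cases ha : a ∈ M.maxAct B s
  · by_cases h1 : a ∈ M.usedAct B d s
    · have h2 : a ∉ M.unusedAct B d s := fun h => by
        rw [unusedAct, Finset.mem_sdiff] at h; exact h.2 h1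
      have h3 : Tendsto (fun e : ℝ => d s a - e * M.actRatio B d s) (𝓝[>] 0) (𝓝 (d s a)) := by
        have : ContinuousAt (fun e : ℝ => d s a - e * M.actRatio B d s) 0 := by fun_prop
        simpa using this.tendsto.mono_left nhdsWithin_le_nhds
      filter_upwards [h3.eventually_const_lt (Finset.mem_filter.1 h1).2] with e he _
      rw [perturb, if_neg h2, if_pos h1]
      exact he
    · have h2 : a ∈ M.unusedAct B d s := by
        rw [unusedAct, Finset.mem_sdiff]; exact ⟨ha, h1⟩
      filter_upwards [self_mem_nhdsWithin] with e he _
      rw [perturb, if_pos h2]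
      exact he
  · exact Eventually.of_forall fun e h => (ha h).elim

/-! ### Optimal policies of the cleaned-up MDP -/

lemma IsCleanOptimal.cost_le_cost_perturb (hact : ∀ s, (M.act s).Nonempty)
    (hB : ∀ s ∈ B, M.IsAbsorbing s) {d : S → A → ℝ} (hd : M.IsCleanOptimal B c β d) {e : ℝ}
    (hpos : ∀ s, ∀ a ∈ M.maxAct B s, 0 < M.perturb B d e s a) :
    M.cost c β (stationary d) ≤ M.cost c β (stationary (M.perturb B d e)) :=
  -- `cleanUp` changes only the available actions, which do not enter the path law, so the two costs
  -- agree by definition.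
  hd.2 _ fun _ => isRule_perturb hact hB hd.1 hpos

lemma cleanUp_act_nonempty (hact : ∀ s, (M.act s).Nonempty) (hB : ∀ s ∈ B, M.IsAbsorbing s)
    (s : S) : ((M.cleanUp B).act s).Nonempty := by
  rw [cleanUp_act hact hB]
  exact maxAct_nonempty hact hB s

/-- The greedy rule of the Bellman equation of the cleaned-up MDP is optimal, also among the
policies of the original MDP that use only actions of `maxAct` in the states that they visit. -/
lemma exists_greedy_rule_cleanUp (hact : ∀ s, (M.act s).Nonempty) (hB : ∀ s ∈ B, M.IsAbsorbing s)
    (c : S → A → ℝ) (hβ0 : 0 ≤ β) (hβ1 : β < 1) :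
    ∃ d, (M.cleanUp B).IsDetRule d ∧ ∀ π ∈ M.policies,
      (∀ t s a, M.occ π M.init t s * π t s a ≠ 0 → a ∈ M.maxAct B s) →
        M.cost c β (stationary d) ≤ M.cost c β π := by
  obtain ⟨v, f, hf, hvf, hv⟩ :=
    exists_bellman_solution (cleanUp_act_nonempty hact hB) c hβ0 hβ1
  have hd := isDetRule_detRule hf
  refine ⟨detRule f, hd, fun π hπ h => ?_⟩
  rw [cost_stationary_eq hβ0 hβ1 (isRule_of_isRule_cleanUp hact hB hd.1) (v := v) fun s => by
    rw [ruleBackup, sum_detRule_mul, sum_detRule_mul]; exact hvf s]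
  refine le_cost hβ0 hβ1 hπ fun t s a hne => hv s a ?_
  rw [cleanUp_act hact hB]
  exact h t s a hne

lemma exists_isCleanOptimal (hact : ∀ s, (M.act s).Nonempty) (hB : ∀ s ∈ B, M.IsAbsorbing s)
    (c : S → A → ℝ) (hβ0 : 0 ≤ β) (hβ1 : β < 1) : ∃ d, M.IsCleanOptimal B c β d := by
  obtain ⟨d, hd, h⟩ := exists_greedy_rule_cleanUp hact hB c hβ0 hβ1
  refine ⟨d, hd, fun π hπ => h π (fun t => isRule_of_isRule_cleanUp hact hB (hπ t))
    fun t s a hne => ?_⟩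
  rw [← cleanUp_act hact hB]
  exact (hπ t).mem_act (right_ne_zero_of_mul hne)

/-- An optimal policy of the cleaned-up MDP is at least as good as every policy that reaches `B`
with maximum probability. -/
lemma IsCleanOptimal.cost_le (hact : ∀ s, (M.act s).Nonempty) (hB : ∀ s ∈ B, M.IsAbsorbing s)
    (hβ0 : 0 ≤ β) (hβ1 : β < 1) {d : S → A → ℝ} (hd : M.IsCleanOptimal B c β d)
    {π : ℕ → S → A → ℝ} (hπ : π ∈ M.maxReachPolicies B) :
    M.cost c β (stationary d) ≤ M.cost c β π := by
  -- In states it never visits `π` may use removed actions, so optimality of `d` does not apply to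
  -- `π` directly; the greedy rule mediates.
  obtain ⟨d', hd', h⟩ := exists_greedy_rule_cleanUp hact hB c hβ0 hβ1
  refine (hd.2 (stationary d') fun _ => hd'.1).trans (h π hπ.1 fun t s a hne => ?_)
  exact mem_maxAct_of_reachProb_eq hact hB hπ.1
    (le_antisymm (reachProb_le_maxReach hπ.1 _) (maxReach_le hact hπ.2)) hne

/-! ### Accuracy of the perturbed policy and existence of admissible weights -/

lemma isEpsOptimal_perturb (hact : ∀ s, (M.act s).Nonempty) (hB : ∀ s ∈ B, M.IsAbsorbing s)
    (hβ0 : 0 ≤ β) (hβ1 : β < 1) {ε : ℝ} (hε : 0 ≤ ε) {d : S → A → ℝ}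
    (hd : M.IsCleanOptimal B c β d) {e : ℝ} (he : M.IsAdmissible B c β d ε e) :
    M.IsEpsOptimal B c β ε (stationary (M.perturb B d e)) := by
  obtain ⟨he0, hpos, hγ⟩ := he
  have hrule := isRule_perturb hact hB hd.1 hpos
  have hmem : stationary (M.perturb B d e) ∈ M.maxReachPolicies B :=
    ⟨fun _ => isRule_of_isRule_cleanUp hact hB hrule, fun π' hπ' => by
      rw [reachProb_stationary_eq_maxReach hact hB hrule hpos]
      exact reachProb_le_maxReach hπ' _⟩
  refine ⟨hmem, ?_⟩
  have hinf : M.cost c β (stationary d) ≤ sInf (M.cost c β '' M.maxReachPolicies B) :=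
    le_csInf ⟨_, _, hmem, rfl⟩ (by rintro _ ⟨π, hπ, rfl⟩; exact hd.cost_le hact hB hβ0 hβ1 hπ)
  have hdiff := cost_perturb_sub_cost (c := c) hact hB hβ0 hβ1 hd.1.1 hrule
  have hnonneg := hd.cost_le_cost_perturb hact hB hpos
  set γ := M.gamma1 B c β d e + M.gamma2 B c β d e
  have hγ0 : 0 ≤ γ := by
    have : 0 ≤ e * γ := by linarith
    exact nonneg_of_mul_nonneg_right this he0
  have hle : e * γ ≤ ε := by
    rcases hγ with h | h
    · rw [h, mul_zero]; exact hε
    · rcases hγ0.eq_or_lt with h0 | h0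
      · rw [← h0, mul_zero]; exact hε
      · exact (le_div_iff₀ h0).1 h
  linarith

/-- The bound on `e` is implicit, since `γ₁` and `γ₂` depend on `e`; it is rewritten as `e * (γ₁ +
γ₂) ≤ ε`, which holds for small `e` by continuity at `0`. -/
lemma exists_isAdmissible (hact : ∀ s, (M.act s).Nonempty) (hB : ∀ s ∈ B, M.IsAbsorbing s)
    (hβ0 : 0 ≤ β) (hβ1 : β < 1) {ε : ℝ} (hε : 0 < ε) {d : S → A → ℝ}
    (hd : M.IsCleanOptimal B c β d) : ∃ e, M.IsAdmissible B c β d ε e := by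
  have hlim : Tendsto (fun e => e * (M.gamma1 B c β d e + M.gamma2 B c β d e)) (𝓝[>] 0) (𝓝 0) := by
    have h : Tendsto (fun e => e * (M.gamma1 B c β d e + M.gamma2 B c β d e)) (𝓝 0)
        (𝓝 (0 * (M.gamma1 B c β d 0 + M.gamma2 B c β d 0))) :=
      tendsto_id.mul (continuousAt_gamma (c := c) hact hB hβ0 hβ1 hd.1.1).tendsto
    rw [zero_mul] at h
    exact h.mono_left nhdsWithin_le_nhds
  obtain ⟨e, he, hpos, he0⟩ := ((hlim.eventually_lt_const hε).and
    ((eventually_perturb_pos (M := M) (B := B) (d := d)).and self_mem_nhdsWithin)).exists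
  refine ⟨e, he0, hpos, ?_⟩
  have hdiff := cost_perturb_sub_cost (c := c) hact hB hβ0 hβ1 hd.1.1
    (isRule_perturb hact hB hd.1 hpos)
  have hnonneg := hd.cost_le_cost_perturb hact hB hpos
  have hγ0 : 0 ≤ M.gamma1 B c β d e + M.gamma2 B c β d e :=
    nonneg_of_mul_nonneg_right (by linarith) he0
  rcases hγ0.eq_or_lt with h | h
  · exact Or.inl h.symm
  · exact Or.inr ((le_div_iff₀ h).2 he.le)

end Law

end MDP

end

/-- Perturbing a discount-optimal stationary deterministic policy of the cleaned-up MDP with an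
admissible weight gives an `ε`-optimal stationary policy; such policies and weights exist, and so
does an `ε`-optimal stationary policy. -/
theorem theorem1 {S A : Type*} [Fintype S] [Fintype A]
    [MeasurableSpace S] [DiscreteMeasurableSpace S]
    [MeasurableSpace A] [DiscreteMeasurableSpace A]
    (M : MDP S A) (hact : ∀ s, (M.act s).Nonempty)
    (B : Set S) (hB : ∀ s ∈ B, M.IsAbsorbing s)
    (c : S → A → ℝ) (hc : ∀ s a, 0 ≤ c s a)
    (β : ℝ) (hβ0 : 0 < β) (hβ1 : β < 1)
    (ε : ℝ) (hε : 0 < ε) :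
    (∀ d, M.IsCleanOptimal B c β d → ∀ e, M.IsAdmissible B c β d ε e →
      MDP.stationary (M.perturb B d e) ∈ (M.cleanUp B).stationaryPolicies ∧
      M.IsEpsOptimal B c β ε (MDP.stationary (M.perturb B d e))) ∧
    (∃ d, M.IsCleanOptimal B c β d) ∧
    (∀ d, M.IsCleanOptimal B c β d → ∃ e, M.IsAdmissible B c β d ε e) ∧
    (∃ π ∈ M.stationaryPolicies, M.IsEpsOptimal B c β ε π) := by
  have h1 : ∀ d, M.IsCleanOptimal B c β d → ∀ e, M.IsAdmissible B c β d ε e →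
      MDP.stationary (M.perturb B d e) ∈ (M.cleanUp B).stationaryPolicies ∧
      M.IsEpsOptimal B c β ε (MDP.stationary (M.perturb B d e)) := fun d hd e he =>
    ⟨⟨fun _ => MDP.isRule_perturb hact hB hd.1 he.2.1, _, rfl⟩,
      MDP.isEpsOptimal_perturb hact hB hβ0.le hβ1 hε.le hd he⟩
  have h2 := MDP.exists_isCleanOptimal hact hB c hβ0.le hβ1
  have h3 : ∀ d, M.IsCleanOptimal B c β d → ∃ e, M.IsAdmissible B c β d ε e := fun d hd =>
    MDP.exists_isAdmissible hact hB hβ0.le hβ1 hε hd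
  refine ⟨h1, h2, h3, ?_⟩
  obtain ⟨d, hd⟩ := h2
  obtain ⟨e, he⟩ := h3 d hd
  have h := (h1 d hd e he).2
  exact ⟨_, ⟨h.1.1, _, rfl⟩, h⟩
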